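/- \textbf{Setting.} Let $M$ be a smooth (Hausdorff) three-dimensional manifold. A \emph{Finsler metric} on $M$ is a continuous function $F\colon TM\to[0,\infty)$ which is smooth and positive off the zero section, satisfies $F(tv)=tF(v)$ for $t>0$, and for which the Hessian $g_{ij}=\partial^2E/\partial y^i\partial y^j$ of $E=\tfrac12F^2$ on each tangent space is positive definite at every $v\neq0$. It is \emph{Riemannian} if $F^2$ restricts to a quadratic form on every tangent space. The \emph{averaged Riemannian metric} is $$\gamma_p(v,w)=\int_{\partial K_p}g(v,w)\,\mu\qquad(v,w\in T_pM),\qquad \partial K_p=F^{-1}(1)\cap T_pM,$$ where $\mu=\sqrt{\det g_{ij}}\,\sum_{i=1}^3(-1)^{i-1}\frac{y^i}{F}\,dy^1\wedge\dots\wedge\widehat{dy^i}\wedge\dots\wedge dy^3$ is the induced volume form on the indicatrix $\partial K_p$. A smooth linear connection $\nabla$ on $M$ is \emph{compatible} to $F$ if its parallel transports preserve the Finslerian length $F(v)$ of tangent vectors, and \emph{flat} if its curvature tensor vanishes. Its torsion $T$ is \emph{totally anti-symmetric} if $T_\flat(X,Y,Z)=\gamma(T(X,Y),Z)$ is an alternating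 $3$-form; then, on every coordinate neighbourhood (with the orientation of the coordinates), there is a unique function $f$ with $T_\flat(\partial_1,\partial_2,\partial_3)=f\sqrt{\det\gamma_{ij}}$, i.e. $T(X,Y)=f\,X\times_\gamma Y$; a change of the orientation replaces $f$ by $-f$. The Finsler manifold is a \emph{generalized Berwald manifold} if it has a compatible linear connection, a \emph{classical Berwald manifold} if it has a compatible linear connection with zero torsion, and a \emph{proper} generalized Berwald manifold if it is generalized but not classical Berwald. \textbf{Theorem.} Let $M$ be a connected three-dimensional non-Riemannian Finsler manifold and let $\nabla$ be a compatible flat linear connection on $M$ whose torsion is totally anti-symmetric. Then one of the following holds: \begin{itemize} \item $M$ is a classical Berwald manifold, $\gamma$ is a (smooth) Riemannian metric of constant zero sectional curvature, and $f\equiv0$ on every coordinate neighbourhood; or \item $M$ is a proper generalized Berwald manifold, $\gamma$ is a (smooth) Riemannian metric of constant positive sectional curvature, and $f$ is a nonzero constant, that is: $f$ is locally constant on every coordinate neighbourhood and $|f|$ is one and the same positive constant on all of $M$. \end{itemize} -/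

import Mathlib

open scoped Manifold ContDiff
open MeasureTheory

noncomputable section

namespace FinslerThree

/-- The model space of three-dimensional manifolds (and of their tangent spaces). -/
abbrev E3 : Type := EuclideanSpace ℝ (Fin 3)

/-- The standard basis of the model space. -/
def stdVec (i : Fin 3) : E3 := EuclideanSpace.single i 1

section

variable (M : Type*) [TopologicalSpace M] [ChartedSpace E3 M] [IsManifold (𝓡 3) ∞ M]

/-- A Finsler metric on a three-dimensional manifold `M`: a continuous function on `TM` that is
smooth off the zero section, positive off the zero section, positively homogeneous of degree one,
and such that the Hessian of `E = F² / 2` on each tangent space is positive definite at every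
nonzero vector. -/
structure FinslerMetric where
  toFun : TangentBundle (𝓡 3) M → ℝ
  continuous_toFun : Continuous toFun
  smooth_toFun : ContMDiffOn (𝓡 3).tangent 𝓘(ℝ, ℝ) ∞ toFun
    {v : TangentBundle (𝓡 3) M | v.2 ≠ 0}
  pos : ∀ (p : M) (v : TangentSpace (𝓡 3) p), v ≠ 0 → 0 < toFun ⟨p, v⟩
  homog : ∀ (p : M) (v : TangentSpace (𝓡 3) p) (t : ℝ), 0 < t →
    toFun ⟨p, t • v⟩ = t * toFun ⟨p, v⟩
  hessian_pos : ∀ (p : M) (v w : E3), v ≠ 0 → w ≠ 0 →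
    0 < fderiv ℝ (fderiv ℝ (fun y : E3 => toFun ⟨p, y⟩ ^ 2 / 2)) v w w

end

variable {M : Type*} [TopologicalSpace M] [ChartedSpace E3 M] [IsManifold (𝓡 3) ∞ M]

namespace FinslerMetric

variable (F : FinslerMetric M) (p : M)

/-- The restriction of the Finsler metric to the tangent space `T_pM`, in the linear coordinates
`y¹, y², y³` of `T_pM` that belong to the preferred chart at `p`. -/
def fiber (y : E3) : ℝ := F.toFun ⟨p, y⟩

/-- The Riemann-Finsler metric `g_y (v, w) = vⁱ wʲ ∂² E / ∂yⁱ ∂yʲ`, where `E = F² / 2`. -/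
def g (y v w : E3) : ℝ := fderiv ℝ (fderiv ℝ (fun z : E3 => F.fiber p z ^ 2 / 2)) y v w

/-- The components `g_ij` at `y`. -/
def gMatrix (y : E3) : Matrix (Fin 3) (Fin 3) ℝ :=
  Matrix.of fun i j => F.g p y (stdVec i) (stdVec j)

/-- The induced volume form of the indicatrix at the point `y`, evaluated on the pair `(a, b)`:
`√(det g_ij) ∑ᵢ (-1)^(i-1) (yⁱ / F) dy¹ ∧ … (omit dyⁱ) … ∧ dy³`. -/
def inducedForm (y a b : E3) : ℝ :=
  Real.sqrt (F.gMatrix p y).det *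
    Matrix.det (Matrix.of ![fun i => y i / F.fiber p y, fun i => a i, fun i => b i])

/-- The central projection of `T_pM` minus the origin onto the indicatrix `F = 1`. -/
def centralProj (u : E3) : E3 := (F.fiber p u)⁻¹ • u

/-- The pullback of the induced volume form under the central projection. -/
def pullbackForm (u a b : E3) : ℝ :=
  F.inducedForm p (F.centralProj p u)
    (fderiv ℝ (F.centralProj p) u a) (fderiv ℝ (F.centralProj p) u b)

/-- The integral `∫ h μ` of a function `h` over the indicatrix `{F = 1} ⊆ T_pM` with respect to the
induced volume form `μ`. The indicatrix is parametrized by the unit coordinate sphere through the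
central projection, and the integral of the pullback `ω` of `h μ` over the outward oriented unit
sphere is the flux `∫ (u¹ ω₂₃ + u² ω₃₁ + u³ ω₁₂) dσ`, where `σ` is the surface measure. -/
def indicatrixIntegral (h : E3 → ℝ) : ℝ :=
  ∫ u : Metric.sphere (0 : E3) 1,
    h (F.centralProj p u) *
      ((u : E3) 0 * F.pullbackForm p u (stdVec 1) (stdVec 2) +
        (u : E3) 1 * F.pullbackForm p u (stdVec 2) (stdVec 0) +
        (u : E3) 2 * F.pullbackForm p u (stdVec 0) (stdVec 1))
    ∂((volume : Measure E3).toSphere)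

/-- The averaged Riemannian metric `γ_p (v, w) = ∫ g (v, w) μ` over the indicatrix at `p`. -/
def averaged (v w : TangentSpace (𝓡 3) p) : ℝ :=
  F.indicatrixIntegral p fun y => F.g p y v w

/-- The Finsler metric is Riemannian if its square is quadratic on each tangent space. -/
def IsRiemannian : Prop :=
  ∀ p : M, ∃ Q : QuadraticForm ℝ (TangentSpace (𝓡 3) p),
    ∀ v : TangentSpace (𝓡 3) p, F.toFun ⟨p, v⟩ ^ 2 = Q v

end FinslerMetric

variable (M) in
/-- Linear connections on the base manifold (as covariant derivatives of vector fields; the value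
`∇ Y p v` is `∇_v Y` at `p`). Smoothness is a separate condition. -/
abbrev Connection : Type _ :=
  CovariantDerivative (𝓡 3) E3 (TangentSpace (𝓡 3) : M → Type _)

/-- Smoothness of a vector field. -/
def SmoothField (X : Π p : M, TangentSpace (𝓡 3) p) : Prop :=
  ContMDiff (𝓡 3) (𝓡 3).tangent ∞ fun p => (⟨p, X p⟩ : TangentBundle (𝓡 3) M)

/-- The vector field on the domain of the preferred chart at `p₀` whose components in this chart
are the constants `v` (extended by zero). For `v = stdVec i` this is `∂/∂uⁱ`. -/
def coordField (p₀ : M) (v : E3) (p : M) : TangentSpace (𝓡 3) p :=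
  (trivializationAt E3 (TangentSpace (𝓡 3)) p₀).symm p v

/-- The components of the tangent vector `w ∈ T_pM` in the preferred chart at `p₀`. -/
def coords (p₀ p : M) (w : TangentSpace (𝓡 3) p) : E3 :=
  (trivializationAt E3 (TangentSpace (𝓡 3)) p₀ (⟨p, w⟩ : TangentBundle (𝓡 3) M)).2

/-- The vector field `X` along the curve `c : [0,1] → M` is parallel: around each parameter its
components in a chart satisfy `(Xᵏ)' = - (cⁱ)' Xʲ Γᵏᵢⱼ(c)`, where `∇_{∂i} ∂j = Γᵏᵢⱼ ∂k`.
(The validity of the equation at `t` does not depend on the chart around `c t`.) -/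
def IsParallelAlong (cov : Connection M) (c : ℝ → M) (X : Π t : ℝ, TangentSpace (𝓡 3) (c t)) :
    Prop :=
  ∀ t ∈ Set.Icc (0 : ℝ) 1, ∃ p₀ : M, c t ∈ (chartAt E3 p₀).source ∧
    HasDerivWithinAt (fun s => coords p₀ (c s) (X s))
      (-coords p₀ (c t)
        (cov (coordField p₀ (coords p₀ (c t) (X t))) (c t)
          (mfderivWithin 𝓘(ℝ, ℝ) (𝓡 3) c (Set.Icc 0 1) t (1 : ℝ))))
      (Set.Icc 0 1) t

/-- The linear connection is compatible to the Finsler metric: its parallel transports along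
smooth curves preserve the Finslerian length of tangent vectors. -/
def IsCompatible (F : FinslerMetric M) (cov : Connection M) : Prop :=
  ∀ (c : ℝ → M) (X : Π t : ℝ, TangentSpace (𝓡 3) (c t)),
    ContMDiffOn 𝓘(ℝ, ℝ) (𝓡 3) ∞ c (Set.Icc 0 1) → IsParallelAlong cov c X →
      F.toFun ⟨c 0, X 0⟩ = F.toFun ⟨c 1, X 1⟩

/-- The curvature `R(X,Y)Z = ∇_X ∇_Y Z - ∇_Y ∇_X Z - ∇_{[X,Y]} Z`. -/
def curvature (cov : Connection M) (X Y Z : Π p : M, TangentSpace (𝓡 3) p) (p : M) :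
    TangentSpace (𝓡 3) p :=
  cov (fun q => cov Z q (Y q)) p (X p) - cov (fun q => cov Z q (X q)) p (Y p) -
    cov Z p (VectorField.mlieBracket (𝓡 3) X Y p)

/-- The connection is flat: its curvature vanishes. -/
def IsFlat (cov : Connection M) : Prop :=
  ∀ X Y Z : Π p : M, TangentSpace (𝓡 3) p, SmoothField X → SmoothField Y → SmoothField Z →
    ∀ p, curvature cov X Y Z p = 0

/-- The torsion is totally anti-symmetric: `γ (T(X,Y), Z)` is an alternating 3-form, where `γ` is
the averaged Riemannian metric. -/
def HasTotallyAntisymmetricTorsion (F : FinslerMetric M) (cov : Connection M) : Prop :=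
  ∀ p : M, ∃ τ : (TangentSpace (𝓡 3) p) [⋀^Fin 3]→ₗ[ℝ] ℝ,
    ∀ u v w : TangentSpace (𝓡 3) p, F.averaged p (cov.torsion p u v) w = τ ![u, v, w]

/-- `F` is a classical Berwald metric: it has a smooth compatible connection without torsion. -/
def IsClassicalBerwald (F : FinslerMetric M) : Prop :=
  ∃ cov : Connection M, cov.ContMDiffCovariantDerivative ∞ ∧ IsCompatible F cov ∧
    cov.torsion = 0

/-- `F` is a generalized Berwald metric: it has a smooth compatible connection. -/
def IsGeneralizedBerwald (F : FinslerMetric M) : Prop :=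
  ∃ cov : Connection M, cov.ContMDiffCovariantDerivative ∞ ∧ IsCompatible F cov

/-- `F` is a proper generalized Berwald metric: generalized Berwald but not classical Berwald. -/
def IsProperGeneralizedBerwald (F : FinslerMetric M) : Prop :=
  IsGeneralizedBerwald F ∧ ¬ IsClassicalBerwald F

variable (M) in
/-- Smooth Riemannian metrics on the manifold `M`. -/
abbrev RMetric : Type _ :=
  Bundle.ContMDiffRiemannianMetric (𝓡 3) ∞ E3 (TangentSpace (𝓡 3) : M → Type _)

/-- `cov` is the Lévi-Civita connection of the Riemannian metric `G`. -/
structure IsLeviCivita (G : RMetric M) (cov : Connection M) : Prop where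
  smooth : cov.ContMDiffCovariantDerivative ∞
  torsion_eq_zero : cov.torsion = 0
  metrical : ∀ Y Z : Π p : M, TangentSpace (𝓡 3) p, SmoothField Y → SmoothField Z →
    ∀ (p : M) (v : TangentSpace (𝓡 3) p),
      mvfderiv (𝓡 3) (fun q => G.inner q (Y q) (Z q)) p v =
        G.inner p (cov Y p v) (Z p) + G.inner p (Y p) (cov Z p v)

/-- The sectional curvature at `p` of the plane spanned by `X p` and `Y p`, where `cov` is the
Lévi-Civita connection of `G`. -/
def sectionalCurvature (G : RMetric M) (cov : Connection M)
    (X Y : Π p : M, TangentSpace (𝓡 3) p) (p : M) : ℝ :=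
  G.inner p (curvature cov X Y Y p) (X p) /
    (G.inner p (X p) (X p) * G.inner p (Y p) (Y p) - G.inner p (X p) (Y p) ^ 2)

/-- The function `γ` on pairs of tangent vectors is a smooth Riemannian metric all of whose
sectional curvatures are equal to `κ`. -/
def HasConstantSectionalCurvature
    (γ : Π p : M, TangentSpace (𝓡 3) p → TangentSpace (𝓡 3) p → ℝ) (κ : ℝ) : Prop :=
  ∃ (G : RMetric M) (cov : Connection M), (∀ p v w, G.inner p v w = γ p v w) ∧
    IsLeviCivita G cov ∧
    ∀ X Y : Π p : M, TangentSpace (𝓡 3) p, SmoothField X → SmoothField Y →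
      ∀ p, LinearIndependent ℝ ![X p, Y p] → sectionalCurvature G cov X Y p = κ

/-- The function `f` with `γ (T(X,Y), Z) = f γ (X × Y, Z)` on the domain of the preferred chart at
`p₀`, oriented by this chart: the quotient of `γ (T(∂₁,∂₂), ∂₃)` by
`γ (∂₁ × ∂₂, ∂₃) = √(det γ_ij)`. -/
def torsionFunction (F : FinslerMetric M) (cov : Connection M) (p₀ p : M) : ℝ :=
  F.averaged p
      (cov.torsion p (coordField p₀ (stdVec 0) p) (coordField p₀ (stdVec 1) p))
      (coordField p₀ (stdVec 2) p) /
    Real.sqrt (Matrix.det (Matrix.of fun i j : Fin 3 =>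
      F.averaged p (coordField p₀ (stdVec i) p) (coordField p₀ (stdVec j) p)))

end FinslerThree

end

/-!
The proof compares the flat connection `∇` with the Levi-Civita connection of the averaged metric
`γ`. It has four ingredients.

*The averaged metric is natural.* On one tangent space, `γ` is the average of the Hessian metric of
a Minkowski norm over its indicatrix. By homogeneity this average is an integral over the solid
indicatrix (`IsMinkowski.avg_eq_solid`), and the change of variables formula shows that linear
isomorphisms of Minkowski norms are isometries of the averages (`IsMinkowski.avg_comp`). The
parallel transports of a compatible connection along coordinate lines
(`IsCompatible.exists_transport`) are therefore isometries of `γ`. Differentiating this yields a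
linear total differential equation for the components of `γ` in a chart
(`IsCompatible.hasDerivAt_localForm`), whose coefficients are the smooth connection coefficients.
Such an equation forces its solutions to be smooth (`contDiffOn_of_totalDifferential`), although
nothing is assumed about the dependence of the integrals on the base point. So `γ` is a smooth
Riemannian metric `G` (`IsCompatible.averagedMetric`), and every compatible connection is metrical
with respect to it (`IsCompatible.isMetrical`).

*The torsion has constant length.* In dimension three, `G(T(X, Y), Z)` being alternating means that
`T` is a multiple of the cross product, so that the Lagrange identity
`|T(X, Y)|² = κ (|X|² |Y|² - G(X, Y)²)` holds, where `κ` is the square of the torsion function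
(`exists_lagrange_identity`). The first Bianchi identity of a flat connection expresses the cyclic
sum of `(∇_X T)(Y, Z)` through `T` (`bianchi_of_isFlat`). Its inner product with `X` leaves only
`G((∇_X T)(Y, Z), X)`, which must vanish (`inner_torsionDeriv_eq_zero`), and then differentiating
the Lagrange identity in the direction `X` gives `X κ = 0` (`IsTorsionFactor.eq`). By continuity the
torsion function is locally constant.

*Curvature.* The Levi-Civita connection of `G` is `∇ - T / 2` (`isLeviCivita_symmetrization`). As
`∇` is flat, its curvature is a combination of `∇T` and `T(T(X, Y), Y)`
(`curvature_symmetrization`); the first term does not contribute to sectional curvatures, and the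
second one shows that they are all equal to `κ / 4` (`sectionalCurvature_symmetrization`).

*Properness.* If `κ = 0` then `∇` itself has no torsion. If `κ ≠ 0` and there were another
compatible connection without torsion, it would be the Levi-Civita connection of `G`, so its
difference to `∇` would be `T / 2`. The parallel transports of both connections preserve the Finsler
metric, so the differential of `F` on `T_pM` annihilates `T(v, y)` at `y`, for all `v`
(`fderiv_connCoeff_sub_eq_zero`). These vectors span the `G`-orthogonal complement of `y`, hence
`F² / G` is constant on `T_pM` (`IsMinkowski.exists_sq_eq`), and `F` is Riemannian
(`isRiemannian_of_isClassicalBerwald`).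
-/

noncomputable section

set_option maxSynthPendingDepth 3

namespace FinslerThree

/-! ### Averaging a Minkowski norm -/

/-- A (possibly irreversible) Minkowski norm on the model space: the properties of the restriction
of a Finsler metric to one tangent space. -/
structure IsMinkowski (N : E3 → ℝ) : Prop where
  smooth : ContDiffOn ℝ ∞ N {0}ᶜ
  pos : ∀ y, y ≠ 0 → 0 < N y
  homog : ∀ (y : E3) (t : ℝ), 0 < t → N (t • y) = t * N y
  hess_pos : ∀ v w : E3, v ≠ 0 → w ≠ 0 →
    0 < fderiv ℝ (fderiv ℝ (fun y : E3 => N y ^ 2 / 2)) v w w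

/-- The Hessian of `N² / 2` at `y`. -/
def hess (N : E3 → ℝ) (y v w : E3) : ℝ := fderiv ℝ (fderiv ℝ (fun z : E3 => N z ^ 2 / 2)) y v w

/-- The components of the Hessian of `N² / 2` in the standard basis. -/
def hessMatrix (N : E3 → ℝ) (y : E3) : Matrix (Fin 3) (Fin 3) ℝ :=
  Matrix.of fun i j => hess N y (stdVec i) (stdVec j)

/-- The Riemannian volume density `√(det g_ij)` of the Hessian metric. -/
def volDensity (N : E3 → ℝ) (y : E3) : ℝ := Real.sqrt (hessMatrix N y).det

/-- The average of the Hessian metric over the indicatrix of `N`, written as an integral over the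
unit sphere of the coordinates. -/
def avg (N : E3 → ℝ) (v w : E3) : ℝ :=
  ∫ u : Metric.sphere (0 : E3) 1, hess N u v w * (volDensity N u * (N u)⁻¹ ^ 3)
    ∂((volume : Measure E3).toSphere)

lemma isOpen_ne_zero : IsOpen ({0}ᶜ : Set E3) := isOpen_compl_singleton

namespace IsMinkowski

variable {N : E3 → ℝ} (hN : IsMinkowski N)
include hN

lemma contDiffOn_energy : ContDiffOn ℝ ∞ (fun z : E3 => N z ^ 2 / 2) {0}ᶜ :=
  (hN.smooth.pow 2).div_const 2

lemma contDiffOn_fderiv : ContDiffOn ℝ ∞ (fderiv ℝ (fun z : E3 => N z ^ 2 / 2)) {0}ᶜ :=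
  hN.contDiffOn_energy.fderiv_of_isOpen isOpen_ne_zero (by simp)

lemma contDiffOn_fderiv_fderiv :
    ContDiffOn ℝ ∞ (fderiv ℝ (fderiv ℝ (fun z : E3 => N z ^ 2 / 2))) {0}ᶜ :=
  hN.contDiffOn_fderiv.fderiv_of_isOpen isOpen_ne_zero (by simp)

lemma continuousOn_hess (v w : E3) : ContinuousOn (fun y => hess N y v w) {0}ᶜ :=
  (hN.contDiffOn_fderiv_fderiv.continuousOn.clm_apply continuousOn_const).clm_apply
    continuousOn_const

lemma continuousOn_volDensity : ContinuousOn (volDensity N) {0}ᶜ := by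
  have : ContinuousOn (hessMatrix N) {0}ᶜ := by
    refine continuousOn_pi.2 fun i => continuousOn_pi.2 fun j => ?_
    exact hN.continuousOn_hess _ _
  refine Real.continuous_sqrt.comp_continuousOn ?_
  exact (Continuous.matrix_det continuous_id).comp_continuousOn this

lemma hess_symm {y : E3} (hy : y ≠ 0) (v w : E3) : hess N y v w = hess N y w v := by
  have h : ContDiffAt ℝ ∞ (fun z : E3 => N z ^ 2 / 2) y :=
    hN.contDiffOn_energy.contDiffAt (isOpen_ne_zero.mem_nhds hy)
  exact (h.isSymmSndFDerivAt (by
    rw [minSmoothness_of_isRCLikeNormedField]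
    exact WithTop.coe_le_coe.2 le_top)) v w

lemma hess_comp (A : E3 ≃L[ℝ] E3) {y : E3} (hy : y ≠ 0) (v w : E3) :
    hess (N ∘ A) y v w = hess N (A y) (A v) (A w) := by
  have hAy : A y ≠ 0 := by simpa using hy
  unfold hess
  have h1 : (fderiv ℝ (fun z : E3 => (N ∘ A) z ^ 2 / 2)) =
      fun z => (ContinuousLinearMap.compL ℝ E3 E3 ℝ).flip (A : E3 →L[ℝ] E3)
        (fderiv ℝ (fun z : E3 => N z ^ 2 / 2) (A z)) := by
    ext1 z
    exact A.comp_right_fderiv (f := fun z : E3 => N z ^ 2 / 2)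
  have hd : DifferentiableAt ℝ (fderiv ℝ (fun z : E3 => N z ^ 2 / 2)) (A y) :=
    (hN.contDiffOn_fderiv.contDiffAt (isOpen_ne_zero.mem_nhds hAy)).differentiableAt (by simp)
  have h2 : HasFDerivAt (fun z => (ContinuousLinearMap.compL ℝ E3 E3 ℝ).flip (A : E3 →L[ℝ] E3)
        (fderiv ℝ (fun z : E3 => N z ^ 2 / 2) (A z)))
      (((ContinuousLinearMap.compL ℝ E3 E3 ℝ).flip (A : E3 →L[ℝ] E3)).comp
        ((fderiv ℝ (fderiv ℝ (fun z : E3 => N z ^ 2 / 2)) (A y)).comp (A : E3 →L[ℝ] E3))) y :=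
    (ContinuousLinearMap.hasFDerivAt _).comp y (hd.hasFDerivAt.comp y A.hasFDerivAt)
  rw [h1, h2.fderiv]
  simp

/-- The Hessian of `N² / 2` is homogeneous of degree zero. -/
lemma hess_smul {t : ℝ} (ht : 0 < t) {y : E3} (hy : y ≠ 0) (v w : E3) :
    hess N (t • y) v w = hess N y v w := by
  let A : E3 ≃L[ℝ] E3 := ContinuousLinearEquiv.smulLeft (Units.mk0 t ht.ne')
  have hA : ∀ z, A z = t • z := fun z => rfl
  have h := hN.hess_comp A hy v w
  simp only [hA] at h
  have h1 : (fun z : E3 => (N ∘ A) z ^ 2 / 2) = fun z => (t ^ 2) • (N z ^ 2 / 2) := by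
    ext z
    simp only [Function.comp, hA, hN.homog z t ht, smul_eq_mul]
    ring
  have h2 : hess (N ∘ A) y v w = t ^ 2 * hess N y v w := by
    unfold hess
    rw [h1]
    have : fderiv ℝ (fun z => (t ^ 2) • (N z ^ 2 / 2)) =
        (t ^ 2) • fderiv ℝ (fun z => (N z ^ 2 / 2)) :=
      fderiv_const_smul_field (t ^ 2) (f := fun z : E3 => N z ^ 2 / 2)
    have h4 : fderiv ℝ ((t ^ 2) • fderiv ℝ (fun z : E3 => N z ^ 2 / 2)) =
        (t ^ 2) • fderiv ℝ (fderiv ℝ (fun z : E3 => N z ^ 2 / 2)) :=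
      fderiv_const_smul_field (t ^ 2) (f := fderiv ℝ (fun z : E3 => N z ^ 2 / 2))
    rw [this, h4]
    simp
  have h3 : hess N (t • y) (t • v) (t • w) = t ^ 2 * hess N (t • y) v w := by
    simp only [hess, map_smul, smul_apply, smul_eq_mul]
    ring
  rw [h2, h3] at h
  exact (mul_left_cancel₀ (by positivity) h).symm

lemma hessMatrix_smul {t : ℝ} (ht : 0 < t) {y : E3} (hy : y ≠ 0) :
    hessMatrix N (t • y) = hessMatrix N y := by
  ext i j
  exact hN.hess_smul ht hy _ _

lemma volDensity_smul {t : ℝ} (ht : 0 < t) {y : E3} (hy : y ≠ 0) :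
    volDensity N (t • y) = volDensity N y := by
  rw [volDensity, hN.hessMatrix_smul ht hy, volDensity]

omit hN in
lemma eq_sum_stdVec (v : E3) : v = ∑ i, v i • stdVec i := by
  ext j
  simp [stdVec, Pi.single_apply]

omit hN in
lemma hess_eq_dotProduct (y v w : E3) :
    hess N y v w = (fun i => v i) ⬝ᵥ (hessMatrix N y).mulVec (fun i => w i) := by
  conv_lhs => rw [eq_sum_stdVec v, eq_sum_stdVec w]
  simp only [hess, map_sum, map_smul, sum_apply,
    smul_apply, smul_eq_mul, dotProduct, Matrix.mulVec, hessMatrix,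
    Matrix.of_apply, Finset.mul_sum]
  rw [Finset.sum_comm]
  refine Finset.sum_congr rfl fun i _ => Finset.sum_congr rfl fun j _ => ?_
  ring

lemma det_hessMatrix_pos {y : E3} (hy : y ≠ 0) : 0 < (hessMatrix N y).det := by
  refine Matrix.PosDef.det_pos ?_
  refine Matrix.PosDef.of_dotProduct_mulVec_pos ?_ fun x hx => ?_
  · ext i j
    simpa [hessMatrix] using hN.hess_symm hy _ _
  · have h := hN.hess_pos y (WithLp.toLp 2 x) hy (by simpa using hx)
    have h2 := hess_eq_dotProduct (N := N) y (WithLp.toLp 2 x) (WithLp.toLp 2 x)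
    simp only [star_trivial]
    exact h2 ▸ h

lemma volDensity_pos {y : E3} (hy : y ≠ 0) : 0 < volDensity N y :=
  Real.sqrt_pos.2 (hN.det_hessMatrix_pos hy)

lemma volDensity_comp (A : E3 ≃L[ℝ] E3) {y : E3} (hy : y ≠ 0) :
    volDensity (N ∘ A) y = |(A : E3 →L[ℝ] E3).det| * volDensity N (A y) := by
  let b : Module.Basis (Fin 3) ℝ E3 := (EuclideanSpace.basisFun (Fin 3) ℝ).toBasis
  let M := LinearMap.toMatrix b b ((A : E3 →L[ℝ] E3) : E3 →ₗ[ℝ] E3)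
  have hM : ∀ i j, M i j = A (stdVec j) i := by
    intro i j
    simp [M, b, LinearMap.toMatrix_apply, stdVec]
  have h : hessMatrix (N ∘ A) y = M.transpose * hessMatrix N (A y) * M := by
    ext i j
    have h1 : hessMatrix (N ∘ A) y i j = hess N (A y) (A (stdVec i)) (A (stdVec j)) :=
      hN.hess_comp A hy _ _
    rw [h1, hess_eq_dotProduct, Matrix.mul_assoc, Matrix.mul_apply]
    simp only [dotProduct, Matrix.mulVec, Matrix.mul_apply, Matrix.transpose_apply, hM]
  rw [volDensity, h, Matrix.det_mul, Matrix.det_mul, Matrix.det_transpose]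
  have hdet : M.det = (A : E3 →L[ℝ] E3).det := LinearMap.det_toMatrix b _
  rw [hdet, show ∀ a c : ℝ, a * c * a = a ^ 2 * c by intros; ring, Real.sqrt_mul (sq_nonneg _),
    Real.sqrt_sq_eq_abs]
  rfl

lemma comp (A : E3 ≃L[ℝ] E3) : IsMinkowski (N ∘ A) where
  smooth := hN.smooth.comp A.contDiff.contDiffOn fun y hy => by simpa using hy
  pos y hy := hN.pos _ (by simpa using hy)
  homog y t ht := by simp [hN.homog _ t ht]
  hess_pos v w hv hw := by
    have := hN.hess_comp A hv w w
    unfold hess at this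
    rw [this]
    exact hN.hess_pos _ _ (by simpa using hv) (by simpa using hw)

/-- The solid region bounded by the indicatrix, without the origin. -/
def solid (N : E3 → ℝ) : Set E3 := {y | y ≠ 0 ∧ N y < 1}

lemma isOpen_solid : IsOpen (solid N) :=
  hN.smooth.continuousOn.isOpen_inter_preimage isOpen_ne_zero isOpen_Iio

/-- The integrand of the average over the solid indicatrix. -/
def integrand (N : E3 → ℝ) (v w y : E3) : ℝ := hess N y v w * volDensity N y

lemma continuousOn_integrand (v w : E3) : ContinuousOn (integrand N v w) {0}ᶜ :=
  (hN.continuousOn_hess v w).mul hN.continuousOn_volDensity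

lemma integrand_smul {t : ℝ} (ht : 0 < t) {y : E3} (hy : y ≠ 0) (v w : E3) :
    integrand N v w (t • y) = integrand N v w y := by
  rw [integrand, hN.hess_smul ht hy, hN.volDensity_smul ht hy, integrand]

omit hN in
lemma sphere_ne_zero (u : Metric.sphere (0 : E3) 1) : (u : E3) ≠ 0 :=
  ne_zero_of_mem_unit_sphere u

omit hN in
lemma _root_.ContinuousOn.continuous_sphere {X : Type*} [TopologicalSpace X] {f : E3 → X}
    (hf : ContinuousOn f {0}ᶜ) : Continuous fun u : Metric.sphere (0 : E3) 1 => f u :=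
  hf.comp_continuous continuous_subtype_val fun u => sphere_ne_zero u

omit hN in
lemma integrable_sphere {f : Metric.sphere (0 : E3) 1 → ℝ} (hf : Continuous f) :
    Integrable f (volume : Measure E3).toSphere :=
  hf.integrable_of_hasCompactSupport (HasCompactSupport.of_compactSpace f)

lemma continuous_avg_integrand (v w : E3) : Continuous fun u : Metric.sphere (0 : E3) 1 =>
    hess N u v w * (volDensity N u * (N u)⁻¹ ^ 3) := by
  refine ContinuousOn.continuous_sphere (f := fun u : E3 =>
    hess N u v w * (volDensity N u * (N u)⁻¹ ^ 3)) ?_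
  refine (hN.continuousOn_hess v w).mul (hN.continuousOn_volDensity.mul ?_)
  exact (hN.smooth.continuousOn.inv₀ fun y hy => (hN.pos y hy).ne').pow 3

/-- By homogeneity, the average over the indicatrix is an integral over the solid indicatrix (polar
coordinates). -/
lemma avg_eq_solid (v w : E3) : avg N v w = 3 * ∫ y in solid N, integrand N v w y := by
  have hpos : ∀ u : Metric.sphere (0 : E3) 1, 0 < N u := fun u => hN.pos _ (sphere_ne_zero u)
  let Ψ : E3 → ℝ := (solid N).indicator (integrand N v w)
  have hmeas : MeasurableSet (solid N) := hN.isOpen_solid.measurableSet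
  have hdim : Module.finrank ℝ E3 - 1 = 2 := by simp
  let g : Metric.sphere (0 : E3) 1 × Set.Ioi (0 : ℝ) → ℝ := fun x => Ψ ((x.2 : ℝ) • (x.1 : E3))
  have hg : ∀ u r, g (u, r) = (Set.Iio (⟨(N u)⁻¹, inv_pos.2 (hpos u)⟩ : Set.Ioi (0 : ℝ))).indicator
      (fun _ => integrand N v w u) r := by
    intro u r
    have hr : 0 < (r : ℝ) := r.2
    have hmem : (r : ℝ) • (u : E3) ∈ solid N ↔
        r ∈ Set.Iio (⟨(N u)⁻¹, inv_pos.2 (hpos u)⟩ : Set.Ioi (0 : ℝ)) := by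
      simp only [solid, Set.mem_ofPred_eq, Set.mem_Iio, ← Subtype.coe_lt_coe, hN.homog _ _ hr]
      rw [← div_eq_mul_inv 1 (N u) |>.trans (one_mul _) , lt_div_iff₀ (hpos u)]
      simp [hr.ne', sphere_ne_zero u]
    change (solid N).indicator (integrand N v w) ((r : ℝ) • (u : E3)) = _
    by_cases h : (r : ℝ) • (u : E3) ∈ solid N
    · rw [Set.indicator_of_mem h, Set.indicator_of_mem (hmem.1 h),
        hN.integrand_smul hr (sphere_ne_zero u)]
    · rw [Set.indicator_of_notMem h, Set.indicator_of_notMem (fun h' => h (hmem.2 h'))]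
  have hvol : ∀ u : Metric.sphere (0 : E3) 1, (Measure.volumeIoiPow 2).real
      (Set.Iio (⟨(N u)⁻¹, inv_pos.2 (hpos u)⟩ : Set.Ioi (0 : ℝ))) = (N u)⁻¹ ^ 3 / 3 := by
    intro u
    have := hpos u
    rw [Measure.real, Measure.volumeIoiPow_apply_Iio, ENNReal.toReal_ofReal (by positivity)]
    norm_num
  have hcont : Continuous fun u : Metric.sphere (0 : E3) 1 =>
      integrand N v w u * ((N u)⁻¹ ^ 3 / 3) := by
    refine ContinuousOn.continuous_sphere
      (f := fun u : E3 => integrand N v w u * ((N u)⁻¹ ^ 3 / 3)) ?_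
    refine (hN.continuousOn_integrand v w).mul (ContinuousOn.div_const ?_ _)
    exact (hN.smooth.continuousOn.inv₀ fun y hy => (hN.pos y hy).ne').pow 3
  have hfin : ∀ u : Metric.sphere (0 : E3) 1, Measure.volumeIoiPow 2
      (Set.Iio (⟨(N u)⁻¹, inv_pos.2 (hpos u)⟩ : Set.Ioi (0 : ℝ))) ≠ ⊤ := by
    intro u
    rw [Measure.volumeIoiPow_apply_Iio]
    exact ENNReal.ofReal_ne_top
  have hmeasg : AEStronglyMeasurable g
      ((volume : Measure E3).toSphere.prod (Measure.volumeIoiPow 2)) := by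
    have h1 : Continuous fun x : Metric.sphere (0 : E3) 1 × Set.Ioi (0 : ℝ) =>
        (x.2 : ℝ) • (x.1 : E3) := by fun_prop
    have h2 : ∀ x : Metric.sphere (0 : E3) 1 × Set.Ioi (0 : ℝ),
        (x.2 : ℝ) • (x.1 : E3) ∈ ({0}ᶜ : Set E3) :=
      fun x => smul_ne_zero (ne_of_gt x.2.2) (sphere_ne_zero x.1)
    have h3 := ((hN.continuousOn_integrand v w).comp_continuous h1 h2)
    exact (h3.measurable.indicator (h1.measurable hmeas)).aestronglyMeasurable
  -- Fubini: along each ray the integrand is constant up to the indicatrix.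
  have hint : Integrable g ((volume : Measure E3).toSphere.prod (Measure.volumeIoiPow 2)) := by
    rw [integrable_prod_iff hmeasg]
    refine ⟨Filter.Eventually.of_forall fun u => ?_, ?_⟩
    · simp only [hg]
      rw [integrable_indicator_iff measurableSet_Iio]
      exact integrableOn_const (hfin u)
    · have : (fun u => ∫ r, ‖g (u, r)‖ ∂Measure.volumeIoiPow 2) =
          fun u : Metric.sphere (0 : E3) 1 => ‖integrand N v w u * ((N u)⁻¹ ^ 3 / 3)‖ := by
        ext u
        have h0 := hpos u
        simp only [hg, norm_indicator_eq_indicator_norm]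
        rw [integral_indicator measurableSet_Iio, setIntegral_const, hvol, norm_mul,
          Real.norm_of_nonneg (by positivity : 0 ≤ (N u)⁻¹ ^ 3 / 3), smul_eq_mul, mul_comm]
      rw [this]
      exact integrable_sphere hcont.norm
  have key : ∫ y in solid N, integrand N v w y =
      ∫ u : Metric.sphere (0 : E3) 1, integrand N v w u * ((N u)⁻¹ ^ 3 / 3)
        ∂(volume : Measure E3).toSphere := by
    calc ∫ y in solid N, integrand N v w y = ∫ y, Ψ y := (integral_indicator hmeas).symm
      _ = ∫ y : ({(0)}ᶜ : Set E3), Ψ y ∂((volume : Measure E3).comap (↑)) := by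
        rw [integral_subtype_comap (measurableSet_singleton _).compl Ψ, restrict_compl_singleton]
      _ = ∫ x, g x ∂((volume : Measure E3).toSphere.prod (Measure.volumeIoiPow 2)) := by
        have h := ((volume : Measure E3).measurePreserving_homeomorphUnitSphereProd).integral_comp
          (Homeomorph.measurableEmbedding _) g
        rw [hdim] at h
        rw [← h]
        refine integral_congr_ae (Filter.Eventually.of_forall fun y => ?_)
        have hy : ‖(y : E3)‖ ≠ 0 := norm_ne_zero_iff.2 y.2
        simp [g, smul_smul, hy]
      _ = _ := by
        rw [integral_prod _ hint]
        refine integral_congr_ae (Filter.Eventually.of_forall fun u => ?_)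
        simp only [hg]
        rw [integral_indicator measurableSet_Iio, setIntegral_const, hvol, smul_eq_mul, mul_comm]
  rw [key, ← integral_const_mul]
  refine integral_congr_ae (Filter.Eventually.of_forall fun u => ?_)
  simp only [integrand]
  ring

/-- The averaged inner product is natural under linear isomorphisms. -/
lemma avg_comp (A : E3 ≃L[ℝ] E3) (v w : E3) : avg (N ∘ A) v w = avg N (A v) (A w) := by
  rw [(hN.comp A).avg_eq_solid, hN.avg_eq_solid]
  congr 1
  have himg : solid N = A '' solid (N ∘ A) := by
    ext z
    constructor
    · rintro ⟨hz, hz'⟩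
      exact ⟨A.symm z, ⟨by simpa using hz, by simpa using hz'⟩, by simp⟩
    · rintro ⟨y, ⟨hy, hy'⟩, rfl⟩
      exact ⟨by simpa using hy, hy'⟩
  rw [himg, integral_image_eq_integral_abs_det_fderiv_smul volume
    (hN.comp A).isOpen_solid.measurableSet (fun x _ => A.hasFDerivAt.hasFDerivWithinAt)
    A.injective.injOn]
  refine setIntegral_congr_fun (hN.comp A).isOpen_solid.measurableSet fun y hy => ?_
  simp only [integrand, hN.hess_comp A hy.1, hN.volDensity_comp A hy.1, smul_eq_mul]
  ring

lemma avg_symm (v w : E3) : avg N v w = avg N w v := by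
  unfold avg
  refine integral_congr_ae (Filter.Eventually.of_forall fun u => ?_)
  simp only [hN.hess_symm (sphere_ne_zero u) v w]

lemma avg_add_left (v v' w : E3) : avg N (v + v') w = avg N v w + avg N v' w := by
  unfold avg
  rw [← integral_add (integrable_sphere (hN.continuous_avg_integrand _ _))
    (integrable_sphere (hN.continuous_avg_integrand _ _))]
  refine integral_congr_ae (Filter.Eventually.of_forall fun u => ?_)
  simp only [hess, map_add, add_apply]
  ring

omit hN in
lemma avg_smul_left (c : ℝ) (v w : E3) : avg N (c • v) w = c * avg N v w := by
  unfold avg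
  rw [← integral_const_mul]
  refine integral_congr_ae (Filter.Eventually.of_forall fun u => ?_)
  simp only [hess, map_smul, smul_apply, smul_eq_mul]
  ring

lemma avg_pos {v : E3} (hv : v ≠ 0) : 0 < avg N v v := by
  unfold avg
  have hpos : ∀ u : Metric.sphere (0 : E3) 1,
      0 < hess N u v v * (volDensity N u * (N u)⁻¹ ^ 3) := fun u =>
    mul_pos (hN.hess_pos _ _ (sphere_ne_zero u) hv)
      (mul_pos (hN.volDensity_pos (sphere_ne_zero u))
        (pow_pos (inv_pos.2 (hN.pos _ (sphere_ne_zero u))) 3))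
  rw [integral_pos_iff_support_of_nonneg (fun u => (hpos u).le)
    (integrable_sphere (hN.continuous_avg_integrand _ _))]
  have : Function.support (fun u : Metric.sphere (0 : E3) 1 =>
      hess N u v v * (volDensity N u * (N u)⁻¹ ^ 3)) = Set.univ := by
    ext u
    simpa using (hpos u).ne'
  rw [this]
  exact Measure.measure_univ_pos.2 (Measure.toSphere_ne_zero _)

/-- The averaged inner product as a continuous bilinear form. -/
def avgForm : E3 →L[ℝ] E3 →L[ℝ] ℝ :=
  LinearMap.toContinuousBilinearMap (LinearMap.mk₂ ℝ (avg N) hN.avg_add_left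
    (fun c v w => avg_smul_left c v w)
    (fun v w w' => by rw [hN.avg_symm, hN.avg_add_left, hN.avg_symm w, hN.avg_symm w'])
    (fun c v w => by rw [hN.avg_symm, avg_smul_left, hN.avg_symm, smul_eq_mul]))

end IsMinkowski

/-! ### The averaged metric of a Finsler metric -/

section Averaged

variable {M : Type*} [TopologicalSpace M] [ChartedSpace E3 M] [IsManifold (𝓡 3) ∞ M]
  (F : FinslerMetric M)

lemma contMDiff_fiber_inclusion (p : M) : ContMDiff 𝓘(ℝ, E3) (𝓡 3).tangent ∞
    (fun y : E3 => (⟨p, y⟩ : TangentBundle (𝓡 3) M)) := by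
  intro y
  rw [Bundle.contMDiffAt_totalSpace]
  refine ⟨contMDiffAt_const, ?_⟩
  have h : (fun y : E3 => (trivializationAt E3 (TangentSpace (𝓡 3)) p
      (⟨p, y⟩ : TangentBundle (𝓡 3) M)).2) =
      fun y : E3 => ((trivializationAt E3 (TangentSpace (𝓡 3)) p).continuousLinearMapAt ℝ p :
        E3 →L[ℝ] E3) y := by
    ext1 y
    exact ((trivializationAt E3 (TangentSpace (𝓡 3)) p).continuousLinearMapAt_apply_of_mem ℝ
      (FiberBundle.mem_baseSet_trivializationAt' p) y).symm
  change ContMDiffAt _ _ _ (fun y : E3 => (trivializationAt E3 (TangentSpace (𝓡 3)) p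
      (⟨p, y⟩ : TangentBundle (𝓡 3) M)).2) y
  rw [h]
  exact (ContinuousLinearMap.contDiff _).contMDiff.contMDiffAt

namespace FinslerMetric

lemma isMinkowski_fiber (p : M) : IsMinkowski (F.fiber p) where
  smooth := by
    have h := F.smooth_toFun.comp (contMDiff_fiber_inclusion p).contMDiffOn (s := {0}ᶜ)
      fun y hy => hy
    exact contMDiffOn_iff_contDiffOn.1 h
  pos := F.pos p
  homog y t ht := F.homog p y t ht
  hess_pos := F.hessian_pos p

/-- The radial part of the differential of the central projection does not contribute to the
pullback of the volume form. -/
lemma pullbackForm_eq (p : M) (u : Metric.sphere (0 : E3) 1) (a b : E3) :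
    F.pullbackForm p u a b = volDensity (F.fiber p) u * (F.fiber p u)⁻¹ ^ 3 *
      Matrix.det (Matrix.of ![fun i => (u : E3) i, fun i => a i, fun i => b i]) := by
  have hN := F.isMinkowski_fiber p
  have hu : (u : E3) ≠ 0 := IsMinkowski.sphere_ne_zero u
  have hpos : 0 < F.fiber p u := hN.pos _ hu
  have hd : HasFDerivAt (F.fiber p) (fderiv ℝ (F.fiber p) u) u :=
    ((hN.smooth.contDiffAt (isOpen_ne_zero.mem_nhds hu)).differentiableAt (by simp)).hasFDerivAt
  have hd' : ∃ α : E3 →L[ℝ] ℝ, HasFDerivAt (fun z => (F.fiber p z)⁻¹) α u :=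
    ⟨_, (hd.differentiableAt.inv hpos.ne').hasFDerivAt⟩
  obtain ⟨α, hα⟩ := hd'
  have hπ : ∀ c : E3, fderiv ℝ (F.centralProj p) u c = (F.fiber p u)⁻¹ • c + α c • (u : E3) := by
    intro c
    have : HasFDerivAt (F.centralProj p) _ u := hα.smul (hasFDerivAt_id (u : E3))
    rw [this.fderiv]
    simp
  have h1 : F.fiber p (F.centralProj p u) = 1 := by
    rw [centralProj, hN.homog _ _ (inv_pos.2 hpos), inv_mul_cancel₀ hpos.ne']
  have h2 : F.gMatrix p (F.centralProj p u) = hessMatrix (F.fiber p) u :=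
    hN.hessMatrix_smul (inv_pos.2 hpos) hu
  rw [pullbackForm, inducedForm, h1, h2, hπ, hπ, volDensity, centralProj]
  simp only [Matrix.det_fin_three, Matrix.of_apply, Matrix.cons_val_zero, Matrix.cons_val_one,
    Matrix.cons_val, PiLp.add_apply, PiLp.smul_apply, smul_eq_mul, div_one]
  ring

/-- On the unit sphere, the flux of the pulled back volume form reduces to a density because
`|u| = 1`. -/
lemma averaged_eq_avg (p : M) (v w : E3) : F.averaged p v w = avg (F.fiber p) v w := by
  have hN := F.isMinkowski_fiber p
  unfold averaged indicatrixIntegral avg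
  refine integral_congr_ae (Filter.Eventually.of_forall fun u => ?_)
  have hu : (u : E3) ≠ 0 := IsMinkowski.sphere_ne_zero u
  have hpos : 0 < F.fiber p u := hN.pos _ hu
  have hg : F.g p (F.centralProj p u) v w = hess (F.fiber p) u v w :=
    hN.hess_smul (inv_pos.2 hpos) hu v w
  have hnorm : (u : E3) 0 ^ 2 + (u : E3) 1 ^ 2 + (u : E3) 2 ^ 2 = 1 := by
    have h := EuclideanSpace.norm_sq_eq (u : E3)
    rw [norm_eq_of_mem_sphere u] at h
    simpa [Fin.sum_univ_three] using h.symm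
  simp only [hg, pullbackForm_eq]
  simp only [Matrix.det_fin_three, Matrix.of_apply, Matrix.cons_val_zero, Matrix.cons_val_one,
    Matrix.cons_val, stdVec, PiLp.single_apply, EuclideanSpace.single, Fin.isValue, one_ne_zero,
    Fin.reduceEq, if_true, if_false]
  linear_combination (hess (F.fiber p) u v w *
    (volDensity (F.fiber p) u * (F.fiber p u)⁻¹ ^ 3)) * hnorm

/-- The Finsler metric on the tangent space at `q`, read in the preferred chart at `p₀`. -/
def localFiber (p₀ q : M) (y : E3) : ℝ := F.toFun ⟨q, coordField p₀ y q⟩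

/-- The averaged metric as a continuous bilinear form on each tangent space. -/
def avgInner (p : M) : TangentSpace (𝓡 3) p →L[ℝ] TangentSpace (𝓡 3) p →L[ℝ] ℝ :=
  (F.isMinkowski_fiber p).avgForm

lemma avgInner_apply (p : M) (v w : TangentSpace (𝓡 3) p) :
    F.avgInner p v w = F.averaged p v w :=
  (F.averaged_eq_avg p v w).symm

lemma avgInner_symm (p : M) (v w : TangentSpace (𝓡 3) p) :
    F.avgInner p v w = F.avgInner p w v :=
  (F.isMinkowski_fiber p).avg_symm v w

lemma avgInner_pos (p : M) {v : TangentSpace (𝓡 3) p} (hv : v ≠ 0) : 0 < F.avgInner p v v :=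
  (F.isMinkowski_fiber p).avg_pos hv

end FinslerMetric

/-- The linear isomorphism of the model space with the tangent space at `q` that belongs to the
preferred chart at `p₀`. -/
def frameEquiv (p₀ q : M) (hq : q ∈ (chartAt E3 p₀).source) :
    E3 ≃L[ℝ] TangentSpace (𝓡 3) q :=
  ((trivializationAt E3 (TangentSpace (𝓡 3)) p₀).continuousLinearEquivAt ℝ q
    (by simpa using hq)).symm

lemma frameEquiv_apply {p₀ q : M} (hq : q ∈ (chartAt E3 p₀).source) (y : E3) :
    frameEquiv p₀ q hq y = coordField p₀ y q := rfl

lemma frameEquiv_symm_apply {p₀ q : M} (hq : q ∈ (chartAt E3 p₀).source)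
    (w : TangentSpace (𝓡 3) q) : (frameEquiv p₀ q hq).symm w = coords p₀ q w := by
  have : q ∈ (trivializationAt E3 (TangentSpace (𝓡 3) : M → Type _) p₀).baseSet := by simpa using hq
  exact (trivializationAt E3 (TangentSpace (𝓡 3)) p₀).continuousLinearEquivAt_apply'
    (R := ℝ) ⟨q, w⟩ this

lemma coords_coordField {p₀ q : M} (hq : q ∈ (chartAt E3 p₀).source) (y : E3) :
    coords p₀ q (coordField p₀ y q) = y := by
  rw [← frameEquiv_apply hq, ← frameEquiv_symm_apply hq, ContinuousLinearEquiv.symm_apply_apply]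

lemma coordField_coords {p₀ q : M} (hq : q ∈ (chartAt E3 p₀).source) (w : TangentSpace (𝓡 3) q) :
    coordField p₀ (coords p₀ q w) q = w := by
  rw [← frameEquiv_apply hq, ← frameEquiv_symm_apply hq, ContinuousLinearEquiv.apply_symm_apply]

namespace FinslerMetric

lemma localFiber_eq {p₀ q : M} (hq : q ∈ (chartAt E3 p₀).source) :
    F.localFiber p₀ q = F.fiber q ∘ (frameEquiv p₀ q hq : E3 ≃L[ℝ] E3) := rfl

lemma isMinkowski_localFiber {p₀ q : M} (hq : q ∈ (chartAt E3 p₀).source) :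
    IsMinkowski (F.localFiber p₀ q) := by
  rw [F.localFiber_eq hq]
  exact (F.isMinkowski_fiber q).comp _

/-- In the preferred chart at `p₀`, the averaged metric is the average of the Minkowski norm read
in that chart. -/
lemma avgInner_coordField {p₀ q : M} (hq : q ∈ (chartAt E3 p₀).source) (v w : E3) :
    F.avgInner q (coordField p₀ v q) (coordField p₀ w q) = avg (F.localFiber p₀ q) v w := by
  rw [F.localFiber_eq hq]
  exact ((F.isMinkowski_fiber q).avg_comp (frameEquiv p₀ q hq) v w).symm

end FinslerMetric
end Averaged

/-! ### Smooth vector fields and connection coefficients -/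

section Fields

open Filter Topology

variable {M : Type*} [TopologicalSpace M] [ChartedSpace E3 M] [IsManifold (𝓡 3) ∞ M]

/-- A vector field that is smooth near a point agrees near this point with a global smooth one. -/
lemma exists_smoothField_eventuallyEq [T2Space M] {σ : Π p : M, TangentSpace (𝓡 3) p} {u : Set M}
    {q : M} (hu : IsOpen u) (hq : q ∈ u)
    (hσ : ContMDiffOn (𝓡 3) (𝓡 3).tangent ∞ (fun p => (⟨p, σ p⟩ : TangentBundle (𝓡 3) M)) u) :
    ∃ X : Π p : M, TangentSpace (𝓡 3) p, SmoothField X ∧ ∀ᶠ p in 𝓝 q, X p = σ p := by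
  obtain ⟨ψ, -, hψ⟩ := (SmoothBumpFunction.nhds_basis_tsupport (I := 𝓡 3) q).mem_iff.1
    (hu.mem_nhds hq)
  refine ⟨(ψ : M → ℝ) • σ, ?_, ?_⟩
  · exact ContMDiffOn.smul_section_of_tsupport ψ.contMDiff.contMDiffOn hu hψ hσ
  · filter_upwards [ψ.eventuallyEq_one] with p hp
    simp [hp]

lemma contMDiffOn_coordField (p₀ : M) (v : E3) :
    ContMDiffOn (𝓡 3) (𝓡 3).tangent ∞
      (fun p => (⟨p, coordField p₀ v p⟩ : TangentBundle (𝓡 3) M)) (chartAt E3 p₀).source := by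
  have h : (chartAt E3 p₀).source =
      (trivializationAt E3 (TangentSpace (𝓡 3) : M → Type _) p₀).baseSet := by simp
  rw [h, Bundle.Trivialization.contMDiffOn_section_baseSet_iff]
  refine (contMDiffOn_const (c := v)).congr fun p hp => ?_
  exact coords_coordField (h ▸ hp) v

lemma mdifferentiableAt_coordField {p₀ q : M} (hq : q ∈ (chartAt E3 p₀).source) (v : E3) :
    MDifferentiableAt (𝓡 3) (𝓡 3).tangent
      (fun p => (⟨p, coordField p₀ v p⟩ : TangentBundle (𝓡 3) M)) q :=
  ((contMDiffOn_coordField p₀ v).contMDiffAt ((chartAt E3 p₀).open_source.mem_nhds hq)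
    ).mdifferentiableAt (by simp)

lemma exists_smoothField_coordField [T2Space M] {p₀ q : M} (hq : q ∈ (chartAt E3 p₀).source)
    (v : E3) : ∃ X : Π p : M, TangentSpace (𝓡 3) p, SmoothField X ∧
      ∀ᶠ p in 𝓝 q, X p = coordField p₀ v p :=
  exists_smoothField_eventuallyEq (chartAt E3 p₀).open_source hq (contMDiffOn_coordField p₀ v)

/-- Every tangent vector is a value of a smooth vector field. -/
lemma exists_smoothField_eq [T2Space M] (q : M) (w : TangentSpace (𝓡 3) q) :
    ∃ X : Π p : M, TangentSpace (𝓡 3) p, SmoothField X ∧ X q = w := by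
  obtain ⟨X, hX, h⟩ := exists_smoothField_coordField (mem_chart_source E3 q) (coords q q w)
  exact ⟨X, hX, h.self_of_nhds.trans (coordField_coords (mem_chart_source E3 q) w)⟩

lemma SmoothField.mdifferentiableAt {X : Π p : M, TangentSpace (𝓡 3) p} (hX : SmoothField X)
    (p : M) : MDifferentiableAt (𝓡 3) (𝓡 3).tangent
      (fun p => (⟨p, X p⟩ : TangentBundle (𝓡 3) M)) p :=
  (hX p).mdifferentiableAt (by simp)

lemma contMDiff_cov {cov : Connection M} (hcov : cov.ContMDiffCovariantDerivative ∞)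
    {Y : Π p : M, TangentSpace (𝓡 3) p} (hY : SmoothField Y) :
    ContMDiff (𝓡 3) ((𝓡 3).prod 𝓘(ℝ, E3 →L[ℝ] E3)) ∞
      (fun p => (⟨p, cov Y p⟩ : Bundle.TotalSpace (E3 →L[ℝ] E3)
        fun x : M => TangentSpace (𝓡 3) x →L[ℝ] TangentSpace (𝓡 3) x)) := by
  have h := hcov.contMDiff.contMDiff (σ := Y) (by
    rw [contMDiffOn_univ]; exact hY)
  rwa [contMDiffOn_univ] at h

lemma SmoothField.cov {cov : Connection M} (hcov : cov.ContMDiffCovariantDerivative ∞)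
    {X Y : Π p : M, TangentSpace (𝓡 3) p} (hX : SmoothField X) (hY : SmoothField Y) :
    SmoothField fun p => cov Y p (X p) := fun p =>
  ContMDiffAt.clm_bundle_apply (contMDiff_cov hcov hY p) (hX p)

/-- The components of a locally smooth vector field in the preferred chart at `p₀` are smooth. -/
lemma contMDiffAt_coords {p₀ q : M} (hq : q ∈ (chartAt E3 p₀).source)
    {X : Π p : M, TangentSpace (𝓡 3) p}
    (hX : ContMDiffAt (𝓡 3) (𝓡 3).tangent ∞ (fun p => (⟨p, X p⟩ : TangentBundle (𝓡 3) M)) q) :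
    ContMDiffAt (𝓡 3) 𝓘(ℝ, E3) ∞ (fun p => coords p₀ p (X p)) q :=
  ((trivializationAt E3 (TangentSpace (𝓡 3) : M → Type _) p₀).contMDiffAt_section_iff
    (by simpa using hq)).1 hX

/-- A smooth function on the manifold read in the preferred chart at `p₀`. -/
lemma contDiffOn_comp_chart_symm {V : Type*} [NormedAddCommGroup V] [NormedSpace ℝ V] (p₀ : M)
    {f : M → V} (hf : ∀ q ∈ (chartAt E3 p₀).source, ContMDiffAt (𝓡 3) 𝓘(ℝ, V) ∞ f q) :
    ContDiffOn ℝ ∞ (f ∘ (extChartAt (𝓡 3) p₀).symm) (extChartAt (𝓡 3) p₀).target := by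
  rw [← contMDiffOn_iff_contDiffOn]
  refine ContMDiffOn.comp (t := (chartAt E3 p₀).source)
    (fun q hq => (hf q hq).contMDiffWithinAt) (contMDiffOn_extChartAt_symm p₀) fun x hx => ?_
  have := (extChartAt (𝓡 3) p₀).map_target hx
  rwa [extChartAt_source] at this

variable (cov : Connection M)

/-- The connection coefficients `Γₖ (∂ᵢ, ∂ⱼ)` in the preferred chart at `p₀` as a bilinear map; the
first argument is the differentiated field, the second one the direction. -/
def connCoeff (p₀ q : M) : E3 →L[ℝ] E3 →L[ℝ] E3 :=
  ∑ j : Fin 3, (EuclideanSpace.proj j : E3 →L[ℝ] ℝ).smulRight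
    (∑ i : Fin 3, (EuclideanSpace.proj i : E3 →L[ℝ] ℝ).smulRight
      (coords p₀ q (cov (coordField p₀ (stdVec j)) q (coordField p₀ (stdVec i) q))))

/-- `∇ ∂ᵥ` at a point of the chart domain depends linearly on `v`. -/
def covCoordField {p₀ q : M} (hq : q ∈ (chartAt E3 p₀).source) :
    E3 →ₗ[ℝ] TangentSpace (𝓡 3) q →L[ℝ] TangentSpace (𝓡 3) q where
  toFun v := cov (coordField p₀ v) q
  map_add' v w := by
    have he : ∀ᶠ p in 𝓝 q, (coordField p₀ v + coordField p₀ w) p = coordField p₀ (v + w) p := by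
      filter_upwards [(chartAt E3 p₀).open_source.mem_nhds hq] with p hp
      exact (map_add (frameEquiv p₀ p hp) v w).symm
    have hd := mdifferentiableAt_coordField hq (v + w)
    rw [← cov.isCovariantDerivativeOnUniv.add (mdifferentiableAt_coordField hq v)
      (mdifferentiableAt_coordField hq w)]
    refine cov.isCovariantDerivativeOnUniv.congr_of_eventuallyEq hd
      (hd.congr_of_eventuallyEq ?_) univ_mem (he.mono fun p hp => hp.symm)
    filter_upwards [he] with p hp
    rw [hp]
  map_smul' c v := by
    have he : ∀ᶠ p in 𝓝 q, (c • coordField p₀ v) p = coordField p₀ (c • v) p := by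
      filter_upwards [(chartAt E3 p₀).open_source.mem_nhds hq] with p hp
      exact (map_smul (frameEquiv p₀ p hp) c v).symm
    have hd := mdifferentiableAt_coordField hq (c • v)
    rw [RingHom.id_apply,
      ← cov.isCovariantDerivativeOnUniv.smul_const c (mdifferentiableAt_coordField hq v)]
    refine cov.isCovariantDerivativeOnUniv.congr_of_eventuallyEq hd
      (hd.congr_of_eventuallyEq ?_) univ_mem (he.mono fun p hp => hp.symm)
    filter_upwards [he] with p hp
    rw [hp]

lemma connCoeff_apply {p₀ q : M} (hq : q ∈ (chartAt E3 p₀).source) (y u : E3) :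
    connCoeff cov p₀ q y u = coords p₀ q (cov (coordField p₀ y) q (coordField p₀ u q)) := by
  have h : coords p₀ q (cov (coordField p₀ y) q (coordField p₀ u q)) =
      (frameEquiv p₀ q hq).symm (covCoordField cov hq y (frameEquiv p₀ q hq u)) :=
    (frameEquiv_symm_apply hq _).symm
  have h' : ∀ i j, coords p₀ q (cov (coordField p₀ (stdVec j)) q (coordField p₀ (stdVec i) q)) =
      (frameEquiv p₀ q hq).symm (covCoordField cov hq (stdVec j) (frameEquiv p₀ q hq (stdVec i))) :=
    fun i j => (frameEquiv_symm_apply hq _).symm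
  rw [h, connCoeff]
  conv_rhs => rw [IsMinkowski.eq_sum_stdVec y, IsMinkowski.eq_sum_stdVec u]
  simp only [h', map_sum, map_smul, sum_apply, smul_apply, ContinuousLinearMap.smulRight_apply,
    Finset.smul_sum]
  rw [Finset.sum_comm]
  refine Finset.sum_congr rfl fun i _ => Finset.sum_congr rfl fun j _ => smul_comm _ _ _

lemma contDiffOn_connCoeff [T2Space M] {cov : Connection M}
    (hcov : cov.ContMDiffCovariantDerivative ∞) (p₀ : M) :
    ContDiffOn ℝ ∞ (connCoeff cov p₀ ∘ (extChartAt (𝓡 3) p₀).symm)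
      (extChartAt (𝓡 3) p₀).target := by
  have key : ∀ i j, ContDiffOn ℝ ∞ ((fun q => coords p₀ q
      (cov (coordField p₀ (stdVec j)) q (coordField p₀ (stdVec i) q))) ∘
        (extChartAt (𝓡 3) p₀).symm) (extChartAt (𝓡 3) p₀).target := by
    intro i j
    refine contDiffOn_comp_chart_symm p₀ fun q hq => contMDiffAt_coords hq ?_
    obtain ⟨Y, hY, hYe⟩ := exists_smoothField_coordField hq (stdVec j)
    obtain ⟨X, hX, hXe⟩ := exists_smoothField_coordField hq (stdVec i)
    refine (SmoothField.cov hcov hX hY q).congr_of_eventuallyEq ?_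
    filter_upwards [hYe.eventually_nhds, hXe, (chartAt E3 p₀).open_source.mem_nhds hq]
      with p hp hp' hps
    rw [hp', cov.isCovariantDerivativeOnUniv.congr_of_eventuallyEq (hY.mdifferentiableAt p)
      (mdifferentiableAt_coordField hps _) univ_mem hp]
  have h : connCoeff cov p₀ ∘ (extChartAt (𝓡 3) p₀).symm = fun x =>
      ∑ j : Fin 3, ContinuousLinearMap.smulRightL ℝ E3 (E3 →L[ℝ] E3) (EuclideanSpace.proj j)
        (∑ i : Fin 3, ContinuousLinearMap.smulRightL ℝ E3 E3 (EuclideanSpace.proj i)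
          (((fun q => coords p₀ q
            (cov (coordField p₀ (stdVec j)) q (coordField p₀ (stdVec i) q))) ∘
              (extChartAt (𝓡 3) p₀).symm) x)) := rfl
  rw [h]
  exact ContDiffOn.sum fun j _ => (ContinuousLinearMap.contDiff _).comp_contDiffOn
    (ContDiffOn.sum fun i _ => (ContinuousLinearMap.contDiff _).comp_contDiffOn (key i j))

end Fields

/-! ### Local parallel transport -/

section Transport

open Filter Topology

variable {M : Type*} [TopologicalSpace M] [ChartedSpace E3 M] [IsManifold (𝓡 3) ∞ M]

/-- A linear homogeneous differential equation with smooth coefficients has a local fundamental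
solution. -/
lemma exists_fundamentalSolution {A : ℝ → E3 →L[ℝ] E3} (hA : ContDiffAt ℝ 1 A 0) :
    ∃ P : ℝ → E3 →L[ℝ] E3, P 0 = ContinuousLinearMap.id ℝ E3 ∧ ∃ ε > 0,
      ∀ t ∈ Set.Ioo (-ε) ε, HasDerivAt P ((A t).comp (P t)) t := by
  -- Time is added as a variable, so that the autonomous Picard-Lindelöf theorem applies.
  let f : ℝ × (E3 →L[ℝ] E3) → ℝ × (E3 →L[ℝ] E3) := fun z => (1, (A z.1).comp z.2)
  have hf : ContDiffAt ℝ 1 f (0, ContinuousLinearMap.id ℝ E3) :=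
    contDiffAt_const.prodMk
      ((ContDiffAt.comp (0, ContinuousLinearMap.id ℝ E3) hA contDiffAt_fst).clm_comp contDiffAt_snd)
  obtain ⟨α, hα0, ε, hε, hα⟩ :=
    hf.exists_forall_mem_closedBall_exists_eq_forall_mem_Ioo_hasDerivAt₀ 0
  simp only [zero_sub, zero_add] at hα
  have h1 : ∀ t ∈ Set.Ioo (-ε) ε, HasDerivAt (fun t => (α t).1) 1 t := fun t ht =>
    (hα t ht).fst
  have h2 : ∀ t ∈ Set.Ioo (-ε) ε, (α t).1 = t := by
    have h3 : Set.EqOn (fun t => (α t).1) id (Set.Ioo (-ε) ε) := by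
      refine isOpen_Ioo.eqOn_of_deriv_eq isPreconnected_Ioo
        (fun t ht => (h1 t ht).differentiableAt.differentiableWithinAt)
        differentiableOn_id (fun t ht => ?_) (x := 0) ⟨by linarith, hε⟩ (by simp [hα0])
      rw [(h1 t ht).deriv]
      simp
    exact h3
  refine ⟨fun t => (α t).2, by simp [hα0], ε, hε, fun t ht => ?_⟩
  have h4 := (hα t ht).snd
  simp only [f, h2 t ht] at h4
  exact h4

/-- Parallel transport of a compatible connection along coordinate lines: it is linear, starts with
velocity given by the connection coefficients, and preserves the Finsler metric. -/
lemma IsCompatible.exists_transport [T2Space M] {F : FinslerMetric M} {cov : Connection M}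
    (hcomp : IsCompatible F cov) (hcov : cov.ContMDiffCovariantDerivative ∞) {p₀ q : M}
    (hq : q ∈ (chartAt E3 p₀).source) (v : E3) :
    ∃ P : ℝ → E3 →L[ℝ] E3, P 0 = ContinuousLinearMap.id ℝ E3 ∧
      HasDerivAt P (-(connCoeff cov p₀ q).flip v) 0 ∧
      ∀ᶠ s in 𝓝 0, ∀ y, F.localFiber p₀
        ((extChartAt (𝓡 3) p₀).symm (extChartAt (𝓡 3) p₀ q + s • v)) (P s y) =
          F.localFiber p₀ q y := by
  set φ := extChartAt (𝓡 3) p₀ with hφ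
  have hqs : q ∈ φ.source := by rwa [hφ, extChartAt_source]
  have hx₀ : φ q ∈ φ.target := φ.map_source hqs
  have hopen : IsOpen φ.target := isOpen_extChartAt_target p₀
  have hC := contDiffOn_connCoeff hcov p₀
  let A : ℝ → E3 →L[ℝ] E3 := fun t => -(connCoeff cov p₀ (φ.symm (φ q + t • v))).flip v
  have hline : ContDiff ℝ ∞ fun t : ℝ => φ q + t • v := by fun_prop
  have hA : ContDiffAt ℝ 1 A 0 := by
    have h1 : ContDiffAt ℝ 1 (connCoeff cov p₀ ∘ φ.symm) (φ q + (0 : ℝ) • v) := by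
      refine ((hC.contDiffAt (hopen.mem_nhds ?_)).of_le (by simp))
      simpa using hx₀
    have h2 : ContDiffAt ℝ 1 ((connCoeff cov p₀ ∘ φ.symm) ∘ fun t : ℝ => φ q + t • v) 0 :=
      ContDiffAt.comp (0 : ℝ) h1 (hline.contDiffAt.of_le (by exact_mod_cast le_top))
    have h3 : ContDiffAt ℝ 1 (fun t : ℝ => (ContinuousLinearMap.flipₗᵢ ℝ E3 E3 E3)
        (((connCoeff cov p₀ ∘ φ.symm) ∘ fun t : ℝ => φ q + t • v) t)) 0 :=
      (LinearIsometryEquiv.contDiff _).contDiffAt.comp (0 : ℝ) h2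
    exact (h3.clm_apply contDiffAt_const).neg
  obtain ⟨P, hP0, ε, hε, hP⟩ := exists_fundamentalSolution hA
  refine ⟨P, hP0, ?_, ?_⟩
  · have h := hP 0 ⟨by linarith, hε⟩
    simpa [A, hP0, φ.left_inv hqs] using h
  have hnear : ∀ᶠ s in 𝓝 (0 : ℝ), φ q + s • v ∈ φ.target := by
    refine (hline.continuous.tendsto 0).eventually (hopen.mem_nhds ?_)
    simpa using hx₀
  obtain ⟨δ, hδ, hball⟩ := Metric.eventually_nhds_iff.1 hnear
  filter_upwards [Metric.ball_mem_nhds (0 : ℝ) (lt_min hε hδ)] with s hs y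
  have hs' : |s| < min ε δ := by simpa using hs
  have hst : ∀ t ∈ Set.Icc (0 : ℝ) 1, |s * t| < min ε δ := by
    intro t ht
    rw [abs_mul, abs_of_nonneg ht.1]
    nlinarith [abs_nonneg s, ht.2, ht.1]
  let c : ℝ → M := fun t => φ.symm (φ q + (s * t) • v)
  let X : Π t, TangentSpace (𝓡 3) (c t) := fun t => coordField p₀ (P (s * t) y) (c t)
  have htarget : ∀ t ∈ Set.Icc (0 : ℝ) 1, φ q + (s * t) • v ∈ φ.target := fun t ht =>
    hball (by simpa using (hst t ht).trans_le (min_le_right _ _))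
  have hsource : ∀ t ∈ Set.Icc (0 : ℝ) 1, c t ∈ (chartAt E3 p₀).source := by
    intro t ht
    have := φ.map_target (htarget t ht)
    rwa [hφ, extChartAt_source] at this
  have hcs : ContDiff ℝ ∞ fun t : ℝ => φ q + (s * t) • v := by fun_prop
  have hc : ContMDiffOn 𝓘(ℝ, ℝ) (𝓡 3) ∞ c (Set.Icc 0 1) :=
    (contMDiffOn_extChartAt_symm p₀).comp hcs.contMDiff.contMDiffOn htarget
  have hX : IsParallelAlong cov c X := by
    intro t ht
    refine ⟨p₀, hsource t ht, ?_⟩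
    have hvel : mfderivWithin 𝓘(ℝ, ℝ) (𝓡 3) c (Set.Icc 0 1) t (1 : ℝ) =
        coordField p₀ (s • v) (c t) := by
      have h1 : HasMFDerivAt 𝓘(ℝ, ℝ) 𝓘(ℝ, E3) (fun t : ℝ => φ q + (s * t) • v) t
          ((ContinuousLinearMap.toSpanSingleton ℝ (s • v))) := by
        have : HasDerivAt (fun t : ℝ => φ q + (s * t) • v) (s • v) t := by
          have := (((hasDerivAt_id t).const_mul s).smul_const v).const_add (φ q)
          simpa using this
        exact this.hasFDerivAt.hasMFDerivAt
      have h2 : HasMFDerivAt 𝓘(ℝ, E3) (𝓡 3) φ.symm (φ q + (s * t) • v)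
          ((trivializationAt E3 (TangentSpace (𝓡 3)) p₀).symmL ℝ (c t)) := by
        rw [TangentBundle.symmL_trivializationAt (hsource t ht)]
        have h3 : MDifferentiableWithinAt 𝓘(ℝ, E3) (𝓡 3) φ.symm (Set.range (𝓡 3))
            (φ q + (s * t) • v) := mdifferentiableWithinAt_extChartAt_symm (htarget t ht)
        have h4 := h3.hasMFDerivWithinAt
        rw [show φ (c t) = φ q + (s * t) • v from φ.right_inv (htarget t ht)]
        rw [(𝓡 3).range_eq_univ] at h4 ⊢
        rwa [hasMFDerivWithinAt_univ] at h4
      have h5 : HasMFDerivAt 𝓘(ℝ, ℝ) (𝓡 3) c t _ := HasMFDerivAt.comp t h2 h1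
      rw [h5.hasMFDerivWithinAt.mfderivWithin
        (uniqueDiffOn_Icc zero_lt_one t ht).uniqueMDiffWithinAt]
      change (trivializationAt E3 (TangentSpace (𝓡 3)) p₀).symmL ℝ (c t)
        ((ContinuousLinearMap.toSpanSingleton ℝ (s • v)) (1 : ℝ)) = _
      rw [ContinuousLinearMap.toSpanSingleton_apply, one_smul]
      exact Bundle.Trivialization.symmL_apply _ (by simpa using hsource t ht) _
    rw [hvel]
    have h6 : coords p₀ (c t) (X t) = P (s * t) y := coords_coordField (hsource t ht) _
    rw [h6, ← connCoeff_apply cov (hsource t ht)]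
    have hmem : s * t ∈ Set.Ioo (-ε) ε := abs_lt.1 ((hst t ht).trans_le (min_le_left _ _))
    have h7 : HasDerivAt (fun r => P (s * r) y)
        (-connCoeff cov p₀ (c t) (P (s * t) y) (s • v)) t := by
      have h8 : HasDerivAt (fun r => P (s * r)) (s • (A (s * t)).comp (P (s * t))) t :=
        HasDerivAt.scomp t (hP _ hmem) (by simpa using (hasDerivAt_id t).const_mul s)
      have h9 := h8.clm_apply (hasDerivAt_const t y)
      simpa [A, c] using h9
    refine h7.hasDerivWithinAt.congr_of_mem (fun r hr => ?_) ht
    exact coords_coordField (hsource r hr) _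
  have h := hcomp c X hc hX
  have h0 : F.localFiber p₀ (c 0) (P (s * 0) y) = F.localFiber p₀ (c 1) (P (s * 1) y) := h
  simp only [c, mul_zero, mul_one, hP0, zero_smul, add_zero, φ.left_inv hqs] at h0
  exact h0.symm

end Transport

/-! ### Regularity of solutions of linear total differential equations -/

section TotalDifferential

open Filter Topology

variable {E B : Type*} [NormedAddCommGroup E] [NormedSpace ℝ E] [NormedAddCommGroup B]
  [NormedSpace ℝ B] {U : Set E} {L : E → E →L[ℝ] B →L[ℝ] B} {h : E → B}

lemma hasDerivAt_along_segment
    (hh : ∀ x ∈ U, ∀ v, HasDerivAt (fun s : ℝ => h (x + s • v)) (L x v (h x)) 0) (x v : E) {t : ℝ}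
    (ht : x + t • v ∈ U) :
    HasDerivAt (fun s : ℝ => h (x + s • v)) (L (x + t • v) v (h (x + t • v))) t := by
  have h1 := hh _ ht v
  have h2 : HasDerivAt (fun s : ℝ => s - t) 1 t := (hasDerivAt_id t).sub_const t
  have h3 : HasDerivAt (fun s : ℝ => h (x + t • v + s • v)) (L (x + t • v) v (h (x + t • v)))
      (t - t) := by simpa using h1
  have h4 := HasDerivAt.scomp (h := fun s : ℝ => s - t) t h3 h2
  rw [one_smul] at h4
  refine h4.congr_of_eventuallyEq (Eventually.of_forall fun s => ?_)
  simp only [Function.comp]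
  congr 1
  module

/-- Solutions are bounded near each point, by the Grönwall inequality along rays. -/
lemma exists_bound_of_totalDifferential (hU : IsOpen U) (hL : ContinuousOn L U)
    (hh : ∀ x ∈ U, ∀ v, HasDerivAt (fun s : ℝ => h (x + s • v)) (L x v (h x)) 0) {x : E}
    (hx : x ∈ U) : ∃ r > 0, ∃ C : ℝ, 0 ≤ C ∧ ∃ K : ℝ, 0 ≤ K ∧ Metric.ball x r ⊆ U ∧
      ∀ y ∈ Metric.ball x r, ‖L y‖ ≤ C ∧ ‖h y‖ ≤ K := by
  have h0 : ContinuousAt (fun y => ‖L y‖) x := (hL.continuousAt (hU.mem_nhds hx)).norm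
  have h1 : ∀ᶠ y in 𝓝 x, ‖L y‖ < ‖L x‖ + 1 := h0.eventually_lt continuousAt_const (lt_add_one _)
  obtain ⟨r, hr, hball⟩ := Metric.eventually_nhds_iff_ball.1 (h1.and (hU.mem_nhds hx))
  set C := ‖L x‖ + 1 with hC
  have hC0 : 0 ≤ C := by positivity
  refine ⟨r, hr, C, hC0, ‖h x‖ * Real.exp (C * r), by positivity,
    fun y hy => (hball y hy).2, fun y hy => ⟨(hball y hy).1.le, ?_⟩⟩
  have hseg : ∀ t ∈ Set.Icc (0 : ℝ) 1, x + t • (y - x) ∈ Metric.ball x r := by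
    intro t ht
    have hy' : ‖y - x‖ < r := by simpa [dist_eq_norm] using hy
    rw [mem_ball_iff_norm, add_sub_cancel_left, norm_smul, Real.norm_of_nonneg ht.1]
    nlinarith [norm_nonneg (y - x), ht.2]
  have hd : ∀ t ∈ Set.Icc (0 : ℝ) 1, HasDerivAt (fun s : ℝ => h (x + s • (y - x)))
      (L (x + t • (y - x)) (y - x) (h (x + t • (y - x)))) t := fun t ht =>
    hasDerivAt_along_segment hh x (y - x) (hball _ (hseg t ht)).2
  have hg := norm_le_gronwallBound_of_norm_deriv_right_le (δ := ‖h x‖) (K := C * r) (ε := 0)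
    (fun t ht => (hd t ht).continuousAt.continuousWithinAt)
    (fun t ht => (hd t (Set.Ico_subset_Icc_self ht)).hasDerivWithinAt) (by simp)
    (fun t ht => by
      have hm := hseg t (Set.Ico_subset_Icc_self ht)
      have hy' : ‖y - x‖ ≤ r := (mem_ball_iff_norm.1 hy).le
      rw [add_zero]
      refine ((L _ _).le_opNorm _).trans ?_
      refine mul_le_mul_of_nonneg_right ?_ (norm_nonneg _)
      refine ((L _).le_opNorm _).trans ?_
      exact mul_le_mul (hball _ hm).1.le hy' (norm_nonneg _) hC0) 1
      (Set.right_mem_Icc.2 zero_le_one)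
  simpa [gronwallBound_ε0] using hg

/-- Solutions are locally Lipschitz, by the mean value inequality along rays. -/
lemma continuousAt_of_totalDifferential (hU : IsOpen U) (hL : ContinuousOn L U)
    (hh : ∀ x ∈ U, ∀ v, HasDerivAt (fun s : ℝ => h (x + s • v)) (L x v (h x)) 0) {x : E}
    (hx : x ∈ U) : ContinuousAt h x := by
  obtain ⟨r, hr, C, hC, K, hK, hsub, hb⟩ := exists_bound_of_totalDifferential hU hL hh hx
  have hlip : ∀ y ∈ Metric.ball x r, ‖h y - h x‖ ≤ C * K * ‖y - x‖ := by
    intro y hy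
    have hseg : ∀ t ∈ Set.Icc (0 : ℝ) 1, x + t • (y - x) ∈ Metric.ball x r := by
      intro t ht
      have hy' : ‖y - x‖ < r := by simpa [dist_eq_norm] using hy
      rw [mem_ball_iff_norm, add_sub_cancel_left, norm_smul, Real.norm_of_nonneg ht.1]
      nlinarith [norm_nonneg (y - x), ht.2]
    have hm := (convex_Icc (0 : ℝ) 1).norm_image_sub_le_of_norm_hasDerivWithin_le
      (f := fun s : ℝ => h (x + s • (y - x))) (C := C * K * ‖y - x‖)
      (fun t ht => (hasDerivAt_along_segment hh x (y - x)
        (hsub (hseg t ht))).hasDerivWithinAt) (fun t ht => by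
        have hm := hb _ (hseg t ht)
        refine ((L _ _).le_opNorm _).trans ?_
        calc ‖L (x + t • (y - x)) (y - x)‖ * ‖h (x + t • (y - x))‖
            ≤ (C * ‖y - x‖) * K := by
              refine mul_le_mul (((L _).le_opNorm _).trans ?_) hm.2 (norm_nonneg _) (by positivity)
              exact mul_le_mul_of_nonneg_right hm.1 (norm_nonneg _)
          _ = C * K * ‖y - x‖ := by ring)
      (Set.left_mem_Icc.2 zero_le_one) (Set.right_mem_Icc.2 zero_le_one)
    simpa using hm
  rw [ContinuousAt, tendsto_iff_norm_sub_tendsto_zero]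
  have hlim : Tendsto (fun y => C * K * ‖y - x‖) (𝓝 x) (𝓝 0) := by
    have : Continuous fun y : E => C * K * ‖y - x‖ := by fun_prop
    simpa using this.tendsto x
  refine squeeze_zero' (Eventually.of_forall fun y => norm_nonneg _) ?_ hlim
  filter_upwards [Metric.ball_mem_nhds x hr] with y hy using hlip y hy

/-- If all directional derivatives satisfy a linear equation with continuous coefficients, the
function is differentiable. -/
lemma hasFDerivAt_of_totalDifferential (hU : IsOpen U) (hL : ContinuousOn L U)
    (hh : ∀ x ∈ U, ∀ v, HasDerivAt (fun s : ℝ => h (x + s • v)) (L x v (h x)) 0) {x : E}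
    (hx : x ∈ U) : HasFDerivAt h ((L x).flip (h x)) x := by
  have hD : ContinuousAt (fun y => (L y).flip (h y)) x := by
    have h1 : ContinuousAt (fun y => ContinuousLinearMap.flipₗᵢ ℝ E B B (L y)) x :=
      (LinearIsometryEquiv.continuous _).continuousAt.comp (hL.continuousAt (hU.mem_nhds hx))
    exact h1.clm_apply (continuousAt_of_totalDifferential hU hL hh hx)
  rw [hasFDerivAt_iff_isLittleO, Asymptotics.isLittleO_iff]
  intro ε hε
  have h1 : ∀ᶠ y in 𝓝 x, ‖(L y).flip (h y) - (L x).flip (h x)‖ < ε := by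
    have := (hD.sub (continuousAt_const (x := x) (y := (L x).flip (h x)))).norm
    exact this.eventually_lt continuousAt_const (by simpa using hε)
  obtain ⟨r, hr, hball⟩ := Metric.eventually_nhds_iff_ball.1 (h1.and (hU.mem_nhds hx))
  filter_upwards [Metric.ball_mem_nhds x hr] with y hy
  have hseg : ∀ t ∈ Set.Icc (0 : ℝ) 1, x + t • (y - x) ∈ Metric.ball x r := by
    intro t ht
    have hy' : ‖y - x‖ < r := by simpa [dist_eq_norm] using hy
    rw [mem_ball_iff_norm, add_sub_cancel_left, norm_smul, Real.norm_of_nonneg ht.1]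
    nlinarith [norm_nonneg (y - x), ht.2]
  have hm := (convex_Icc (0 : ℝ) 1).norm_image_sub_le_of_norm_hasDerivWithin_le
    (f := fun s : ℝ => h (x + s • (y - x)) - s • (L x).flip (h x) (y - x)) (C := ε * ‖y - x‖)
    (f' := fun t => ((L (x + t • (y - x))).flip (h (x + t • (y - x))) - (L x).flip (h x)) (y - x))
    (fun t ht => by
      have h2 := (hasDerivAt_along_segment hh x (y - x) (hball _ (hseg t ht)).2).sub
        ((hasDerivAt_id t).smul_const ((L x).flip (h x) (y - x)))
      simp only [id, one_smul] at h2
      exact h2.hasDerivWithinAt)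
    (fun t ht => (ContinuousLinearMap.le_opNorm _ _).trans
      (mul_le_mul_of_nonneg_right (hball _ (hseg t ht)).1.le (norm_nonneg _)))
    (Set.left_mem_Icc.2 zero_le_one) (Set.right_mem_Icc.2 zero_le_one)
  simp only [one_smul, zero_smul, add_zero, sub_zero, add_sub_cancel, norm_one, mul_one] at hm
  rwa [sub_right_comm] at hm

/-- Bootstrapping: solutions of a linear total differential equation with smooth coefficients are
smooth. -/
lemma contDiffOn_of_totalDifferential (hU : IsOpen U) (hL : ContDiffOn ℝ ∞ L U)
    (hh : ∀ x ∈ U, ∀ v, HasDerivAt (fun s : ℝ => h (x + s • v)) (L x v (h x)) 0) :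
    ContDiffOn ℝ ∞ h U := by
  have hd : ∀ x ∈ U, HasFDerivAt h ((L x).flip (h x)) x := fun x hx =>
    hasFDerivAt_of_totalDifferential hU hL.continuousOn hh hx
  rw [contDiffOn_infty]
  intro n
  induction n with
  | zero =>
    rw [Nat.cast_zero, contDiffOn_zero]
    exact fun x hx => (hd x hx).continuousAt.continuousWithinAt
  | succ n ih =>
    rw [Nat.cast_succ, contDiffOn_succ_iff_fderiv_of_isOpen hU]
    refine ⟨fun x hx => (hd x hx).differentiableAt.differentiableWithinAt, by simp, ?_⟩
    have h1 : ContDiffOn ℝ n (fun y => ContinuousLinearMap.flipₗᵢ ℝ E B B (L y)) U :=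
      (LinearIsometryEquiv.contDiff _).comp_contDiffOn (hL.of_le (by exact_mod_cast le_top))
    exact (h1.clm_apply ih).congr fun x hx => (hd x hx).fderiv

end TotalDifferential

/-! ### Smoothness of the averaged metric -/

section Smooth

open Filter Topology

/-- The velocity of the inverses of a curve through the unit of a Banach algebra. -/
lemma hasDerivAt_ringInverse {R : Type*} [NormedRing R] [NormedAlgebra ℝ R] [CompleteSpace R]
    {P : ℝ → R} {A : R} (hP0 : P 0 = 1) (hP : HasDerivAt P (-A) 0) :
    HasDerivAt (fun s => Ring.inverse (P s)) A 0 := by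
  have h := hasFDerivAt_ringInverse (𝕜 := ℝ) (1 : Rˣ)
  rw [Units.val_one, ← hP0] at h
  refine (h.comp_hasDerivAt (0 : ℝ) hP).congr_deriv ?_
  simp

section Action

variable {V : Type*} [NormedAddCommGroup V] [NormedSpace ℝ V]

/-- Exchanging the arguments of a bilinear form. -/
def flipForm : (V →L[ℝ] V →L[ℝ] ℝ) →L[ℝ] (V →L[ℝ] V →L[ℝ] ℝ) :=
  (ContinuousLinearMap.flipₗᵢ ℝ V V ℝ).toContinuousLinearEquiv.toContinuousLinearMap

/-- Precomposing the first argument of a bilinear form with an endomorphism. -/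
def precompForm : (V →L[ℝ] V) →L[ℝ] (V →L[ℝ] V →L[ℝ] ℝ) →L[ℝ] (V →L[ℝ] V →L[ℝ] ℝ) :=
  (ContinuousLinearMap.compL ℝ V V (V →L[ℝ] ℝ)).flip

/-- The derivative action of an endomorphism `A` on bilinear forms,
`(A · b)(y, z) = b(A y, z) + b(y, A z)`. -/
def derivAction : (V →L[ℝ] V) →L[ℝ] (V →L[ℝ] V →L[ℝ] ℝ) →L[ℝ] (V →L[ℝ] V →L[ℝ] ℝ) :=
  precompForm + (ContinuousLinearMap.compL ℝ (V →L[ℝ] V →L[ℝ] ℝ) (V →L[ℝ] V →L[ℝ] ℝ)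
      (V →L[ℝ] V →L[ℝ] ℝ) flipForm).comp
    (((ContinuousLinearMap.compL ℝ (V →L[ℝ] V →L[ℝ] ℝ) (V →L[ℝ] V →L[ℝ] ℝ)
      (V →L[ℝ] V →L[ℝ] ℝ)).flip flipForm).comp precompForm)

lemma derivAction_apply (A : V →L[ℝ] V) (b : V →L[ℝ] V →L[ℝ] ℝ) (y z : V) :
    derivAction A b y z = b (A y) z + b y (A z) := rfl

/-- If `P s` carries the bilinear form `b 0` to `b s`, then the velocity of `b` is given by the
velocity of `P`. -/
lemma hasDerivAt_of_isometry [CompleteSpace V] {b : ℝ → V →L[ℝ] V →L[ℝ] ℝ} {P : ℝ → V →L[ℝ] V}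
    {A : V →L[ℝ] V} (hP0 : P 0 = 1) (hP : HasDerivAt P (-A) 0)
    (hb : ∀ᶠ s in 𝓝 0, IsUnit (P s) → ∀ y z, b s (P s y) (P s z) = b 0 y z) :
    HasDerivAt b (derivAction A (b 0)) 0 := by
  let Q : ℝ → V →L[ℝ] V := fun s => Ring.inverse (P s)
  have hunit : ∀ᶠ s in 𝓝 0, IsUnit (P s) := by
    have : IsUnit (P 0) := by rw [hP0]; exact isUnit_one
    exact hP.continuousAt.eventually (Units.isOpen.mem_nhds this)
  have hQ0 : Q 0 = 1 := by
    simp only [Q, hP0]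
    exact Ring.inverse_one _
  have hQ : HasDerivAt Q A 0 := hasDerivAt_ringInverse hP0 hP
  -- `b s` is the pullback of `b 0` by `Q s = (P s)⁻¹`.
  have h1 : HasDerivAt (fun s => (((b 0).comp (Q s)).flip.comp (Q s)).flip)
      (derivAction A (b 0)) 0 := by
    have h2 : HasDerivAt (fun s => (b 0).comp (Q s)) ((b 0).comp A) 0 :=
      (ContinuousLinearMap.compL ℝ V V (V →L[ℝ] ℝ) (b 0)).hasFDerivAt.comp_hasDerivAt (0 : ℝ) hQ
    have h3 : HasDerivAt (fun s => ((b 0).comp (Q s)).flip) ((b 0).comp A).flip 0 :=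
      (flipForm (V := V)).hasFDerivAt.comp_hasDerivAt (0 : ℝ) h2
    have h4 := (flipForm (V := V)).hasFDerivAt.comp_hasDerivAt (0 : ℝ) (h3.clm_comp hQ)
    refine h4.congr_deriv ?_
    ext y z
    rw [derivAction_apply, hQ0]
    rfl
  refine h1.congr_of_eventuallyEq ?_
  filter_upwards [hunit, hb] with s hu hs
  have hs := hs hu
  have hPQ : ∀ y, P s (Q s y) = y := fun y => by
    have := Ring.mul_inverse_cancel (P s) hu
    exact congrArg (fun T : V →L[ℝ] V => T y) this
  ext y z
  have := hs (Q s y) (Q s z)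
  rw [hPQ, hPQ] at this
  exact this

end Action

variable {M : Type*} [TopologicalSpace M] [ChartedSpace E3 M] [IsManifold (𝓡 3) ∞ M]
  (F : FinslerMetric M)

/-- The averaged metric in the preferred chart at `p₀`. -/
def FinslerMetric.localForm (p₀ q : M) : E3 →L[ℝ] E3 →L[ℝ] ℝ :=
  let T : E3 →L[ℝ] E3 := (trivializationAt E3 (TangentSpace (𝓡 3)) p₀).symmL ℝ q
  (F.isMinkowski_fiber q).avgForm.bilinearComp T T

lemma FinslerMetric.localForm_apply {p₀ q : M} (hq : q ∈ (chartAt E3 p₀).source) (y z : E3) :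
    F.localForm p₀ q y z = F.avgInner q (coordField p₀ y q) (coordField p₀ z q) := by
  have hq' : q ∈ (trivializationAt E3 (TangentSpace (𝓡 3) : M → Type _) p₀).baseSet := by
    simpa using hq
  have h : ∀ y, (trivializationAt E3 (TangentSpace (𝓡 3) : M → Type _) p₀).symmL ℝ q y =
      coordField p₀ y q := fun y => Bundle.Trivialization.symmL_apply _ hq' y
  rw [← h, ← h]
  rfl

variable {F}

/-- The averaged metric is parallel with respect to every compatible connection. -/
lemma IsCompatible.hasDerivAt_localForm [T2Space M] {cov : Connection M}
    (hcomp : IsCompatible F cov) (hcov : cov.ContMDiffCovariantDerivative ∞) {p₀ q : M}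
    (hq : q ∈ (chartAt E3 p₀).source) (v : E3) :
    HasDerivAt (fun s : ℝ => F.localForm p₀
        ((extChartAt (𝓡 3) p₀).symm (extChartAt (𝓡 3) p₀ q + s • v)))
      (derivAction ((connCoeff cov p₀ q).flip v) (F.localForm p₀ q)) 0 := by
  obtain ⟨P, hP0, hP, hF⟩ := hcomp.exists_transport hcov hq v
  have hqs : q ∈ (extChartAt (𝓡 3) p₀).source := by rwa [extChartAt_source]
  have h0 : (extChartAt (𝓡 3) p₀).symm (extChartAt (𝓡 3) p₀ q + (0 : ℝ) • v) = q := by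
    rw [zero_smul, add_zero, (extChartAt (𝓡 3) p₀).left_inv hqs]
  have hsrc : ∀ᶠ s : ℝ in 𝓝 0, (extChartAt (𝓡 3) p₀).symm (extChartAt (𝓡 3) p₀ q + s • v) ∈
      (chartAt E3 p₀).source := by
    have hc : Continuous fun s : ℝ => extChartAt (𝓡 3) p₀ q + s • v := by fun_prop
    have := (hc.tendsto 0).eventually ((isOpen_extChartAt_target (I := 𝓡 3) p₀).mem_nhds
      (by simpa using (extChartAt (𝓡 3) p₀).map_source hqs))
    filter_upwards [this] with s hs
    have := (extChartAt (𝓡 3) p₀).map_target hs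
    rwa [extChartAt_source] at this
  have key := hasDerivAt_of_isometry (A := (connCoeff cov p₀ q).flip v)
    (b := fun s : ℝ => F.localForm p₀
        ((extChartAt (𝓡 3) p₀).symm (extChartAt (𝓡 3) p₀ q + s • v))) hP0 hP (by
      filter_upwards [hF, hsrc] with s hs hsr hu y z
      rw [h0, F.localForm_apply hsr, F.localForm_apply hq, F.avgInner_coordField hsr,
        F.avgInner_coordField hq]
      obtain ⟨A, hA⟩ := hu
      let A' : E3 ≃L[ℝ] E3 := ContinuousLinearEquiv.unitsEquiv ℝ E3 A
      have hA' : ∀ y, A' y = P s y := fun y => by rw [← hA]; rfl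
      have hcomp : F.localFiber p₀ q = F.localFiber p₀
          ((extChartAt (𝓡 3) p₀).symm (extChartAt (𝓡 3) p₀ q + s • v)) ∘ A' := by
        ext y
        rw [Function.comp, hA', hs]
      rw [hcomp, (F.isMinkowski_localFiber hsr).avg_comp, hA', hA'])
  simpa only [h0] using key

end Smooth

section Metric

open Filter Topology

variable {M : Type*} [TopologicalSpace M] [ChartedSpace E3 M] [IsManifold (𝓡 3) ∞ M]
  {F : FinslerMetric M} {cov : Connection M}

/-- The unit ball of a positive definite form on `E3` is bounded. -/
lemma isVonNBounded_of_pos (B : E3 →L[ℝ] E3 →L[ℝ] ℝ) (hB : ∀ v, v ≠ 0 → 0 < B v v) :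
    Bornology.IsVonNBounded ℝ {v : E3 | B v v < 1} := by
  have hc : Continuous fun v : E3 => B v v := by fun_prop
  obtain ⟨u, hu, hmin⟩ := (isCompact_sphere (0 : E3) 1).exists_isMinOn
    (NormedSpace.sphere_nonempty.2 zero_le_one) hc.continuousOn
  have hu0 : u ≠ 0 := by
    rintro rfl
    simp at hu
  have hm := hB u hu0
  rw [NormedSpace.isVonNBounded_iff, isBounded_iff_forall_norm_le]
  refine ⟨Real.sqrt (1 / B u u), fun v hv => Real.le_sqrt_of_sq_le ?_⟩
  have hv : B v v < 1 := hv
  rcases eq_or_ne v 0 with rfl | h0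
  · simpa using hm.le
  have hn : 0 < ‖v‖ := norm_pos_iff.2 h0
  have h1 : B u u ≤ B (‖v‖⁻¹ • v) (‖v‖⁻¹ • v) :=
    hmin (by simp [norm_smul, inv_mul_cancel₀ hn.ne'])
  have h2 : B (‖v‖⁻¹ • v) (‖v‖⁻¹ • v) * ‖v‖ ^ 2 = B v v := by
    simp only [map_smul, smul_apply, smul_eq_mul]
    field_simp
  rw [le_div_iff₀ hm]
  nlinarith [sq_nonneg ‖v‖]

/-- Coordinate lines have constant components as velocity. -/
lemma hasMFDerivAt_chartLine {p₀ q : M} (hq : q ∈ (chartAt E3 p₀).source) (v : E3) :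
    HasMFDerivAt 𝓘(ℝ, ℝ) (𝓡 3)
      (fun s : ℝ => (extChartAt (𝓡 3) p₀).symm (extChartAt (𝓡 3) p₀ q + s • v)) 0
      (((trivializationAt E3 (TangentSpace (𝓡 3)) p₀).symmL ℝ q).comp
        (ContinuousLinearMap.toSpanSingleton ℝ v)) := by
  set φ := extChartAt (𝓡 3) p₀ with hφ
  have hqs : q ∈ φ.source := by rwa [hφ, extChartAt_source]
  have hx : φ q + (0 : ℝ) • v = φ q := by simp
  have h1 : HasMFDerivAt 𝓘(ℝ, ℝ) 𝓘(ℝ, E3) (fun t : ℝ => φ q + t • v) 0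
      (ContinuousLinearMap.toSpanSingleton ℝ v) := by
    have : HasDerivAt (fun t : ℝ => φ q + t • v) v 0 := by
      simpa using ((hasDerivAt_id (0 : ℝ)).smul_const v).const_add (φ q)
    exact this.hasFDerivAt.hasMFDerivAt
  have h2 : HasMFDerivAt 𝓘(ℝ, E3) (𝓡 3) φ.symm (φ q)
      ((trivializationAt E3 (TangentSpace (𝓡 3)) p₀).symmL ℝ q) := by
    rw [TangentBundle.symmL_trivializationAt hq]
    have h4 := (mdifferentiableWithinAt_extChartAt_symm (I := 𝓡 3)
      (φ.map_source hqs)).hasMFDerivWithinAt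
    rw [(𝓡 3).range_eq_univ] at h4 ⊢
    rw [hasMFDerivWithinAt_univ] at h4
    exact h4
  have h3 : ∀ x, x = φ q → HasMFDerivAt 𝓘(ℝ, E3) (𝓡 3) φ.symm x
      ((trivializationAt E3 (TangentSpace (𝓡 3)) p₀).symmL ℝ q) := by
    rintro x rfl
    exact h2
  exact HasMFDerivAt.comp 0 (h3 _ hx) h1

lemma hasDerivAt_comp_chartLine {p₀ q : M} (hq : q ∈ (chartAt E3 p₀).source) (v : E3) {f : M → ℝ}
    (hf : MDifferentiableAt (𝓡 3) 𝓘(ℝ, ℝ) f q) :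
    HasDerivAt (fun s : ℝ => f ((extChartAt (𝓡 3) p₀).symm (extChartAt (𝓡 3) p₀ q + s • v)))
      (mvfderiv (𝓡 3) f q (coordField p₀ v q)) 0 := by
  have h1 := hasMFDerivAt_chartLine hq v
  have hx : (extChartAt (𝓡 3) p₀).symm (extChartAt (𝓡 3) p₀ q + (0 : ℝ) • v) = q := by
    rw [zero_smul, add_zero, (extChartAt (𝓡 3) p₀).left_inv (by rwa [extChartAt_source])]
  have h2 : ∀ x, x = q → HasMFDerivAt (𝓡 3) 𝓘(ℝ, ℝ) f x (mfderiv (𝓡 3) 𝓘(ℝ, ℝ) f q) := by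
    rintro x rfl
    exact hf.hasMFDerivAt
  have h3 : HasMFDerivAt 𝓘(ℝ, ℝ) 𝓘(ℝ, ℝ) (fun s : ℝ =>
      f ((extChartAt (𝓡 3) p₀).symm (extChartAt (𝓡 3) p₀ q + s • v))) 0 _ :=
    HasMFDerivAt.comp 0 (h2 _ hx) h1
  let D : ℝ →L[ℝ] ℝ := (mvfderiv (𝓡 3) f q).comp
    (((trivializationAt E3 (TangentSpace (𝓡 3)) p₀).symmL ℝ q).comp
      (ContinuousLinearMap.toSpanSingleton ℝ v))
  have h4 : HasFDerivAt (fun s : ℝ =>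
      f ((extChartAt (𝓡 3) p₀).symm (extChartAt (𝓡 3) p₀ q + s • v))) D 0 :=
    hasMFDerivAt_iff_hasFDerivAt.1 h3
  refine h4.hasDerivAt.congr_deriv ?_
  change mvfderiv (𝓡 3) f q ((trivializationAt E3 (TangentSpace (𝓡 3)) p₀).symmL ℝ q
    ((ContinuousLinearMap.toSpanSingleton ℝ v) (1 : ℝ))) = _
  rw [ContinuousLinearMap.toSpanSingleton_apply, one_smul]
  exact congrArg (mvfderiv (𝓡 3) f q)
    (Bundle.Trivialization.symmL_apply _ (by simpa using hq) v)

lemma IsCompatible.contDiffOn_localForm [T2Space M] (hcomp : IsCompatible F cov)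
    (hcov : cov.ContMDiffCovariantDerivative ∞) (p₀ : M) :
    ContDiffOn ℝ ∞ (F.localForm p₀ ∘ (extChartAt (𝓡 3) p₀).symm) (extChartAt (𝓡 3) p₀).target := by
  refine contDiffOn_of_totalDifferential (isOpen_extChartAt_target p₀)
    (L := fun x => derivAction.comp
      (connCoeff cov p₀ ((extChartAt (𝓡 3) p₀).symm x)).flip) ?_ ?_
  · have h1 : ContDiffOn ℝ ∞ (fun x => ContinuousLinearMap.flipₗᵢ ℝ E3 E3 E3
        ((connCoeff cov p₀ ∘ (extChartAt (𝓡 3) p₀).symm) x)) (extChartAt (𝓡 3) p₀).target :=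
      (LinearIsometryEquiv.contDiff _).comp_contDiffOn (contDiffOn_connCoeff hcov p₀)
    exact (contDiffOn_const (c := derivAction (V := E3))).clm_comp h1
  · intro x hx v
    have hsrc : (extChartAt (𝓡 3) p₀).symm x ∈ (chartAt E3 p₀).source := by
      simpa [extChartAt_source] using (extChartAt (𝓡 3) p₀).map_target hx
    have := hcomp.hasDerivAt_localForm hcov hsrc v
    rwa [(extChartAt (𝓡 3) p₀).right_inv hx] at this

lemma IsCompatible.contMDiffAt_localForm [T2Space M] (hcomp : IsCompatible F cov)
    (hcov : cov.ContMDiffCovariantDerivative ∞) {p₀ q : M} (hq : q ∈ (chartAt E3 p₀).source) :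
    ContMDiffAt (𝓡 3) 𝓘(ℝ, E3 →L[ℝ] E3 →L[ℝ] ℝ) ∞ (F.localForm p₀) q := by
  have hqs : q ∈ (extChartAt (𝓡 3) p₀).source := by rwa [extChartAt_source]
  have h1 : ContMDiffAt 𝓘(ℝ, E3) 𝓘(ℝ, E3 →L[ℝ] E3 →L[ℝ] ℝ) ∞
      (F.localForm p₀ ∘ (extChartAt (𝓡 3) p₀).symm) (extChartAt (𝓡 3) p₀ q) :=
    ((hcomp.contDiffOn_localForm hcov p₀).contDiffAt ((isOpen_extChartAt_target p₀).mem_nhds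
      ((extChartAt (𝓡 3) p₀).map_source hqs))).contMDiffAt
  refine (h1.comp q (contMDiffAt_extChartAt' hq)).congr_of_eventuallyEq ?_
  filter_upwards [(chartAt E3 p₀).open_source.mem_nhds hq] with p hp
  simp only [Function.comp]
  rw [(extChartAt (𝓡 3) p₀).left_inv (by rwa [extChartAt_source])]

/-- The averaged metric of a Finsler metric with a smooth compatible connection is a smooth
Riemannian metric. -/
def IsCompatible.averagedMetric [T2Space M] (hcomp : IsCompatible F cov)
    (hcov : cov.ContMDiffCovariantDerivative ∞) : RMetric M where
  inner := F.avgInner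
  symm := F.avgInner_symm
  pos p v hv := F.avgInner_pos p hv
  isVonNBounded p := isVonNBounded_of_pos (F.isMinkowski_fiber p).avgForm
    fun v hv => F.avgInner_pos p hv
  contMDiff := by
    intro p
    rw [contMDiffAt_hom_bundle]
    refine ⟨contMDiffAt_id, ?_⟩
    refine (hcomp.contMDiffAt_localForm hcov (mem_chart_source E3 p)).congr_of_eventuallyEq ?_
    filter_upwards [(chartAt E3 p).open_source.mem_nhds (mem_chart_source E3 p)] with q hq
    ext v w
    rw [inCoordinates_apply_eq₂ (by simpa using hq) (by simpa using hq) (by simp),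
      F.localForm_apply hq]
    simp
    rfl

@[simp] lemma IsCompatible.averagedMetric_inner [T2Space M] (hcomp : IsCompatible F cov)
    (hcov : cov.ContMDiffCovariantDerivative ∞) (p : M) (v w : TangentSpace (𝓡 3) p) :
    (hcomp.averagedMetric hcov).inner p v w = F.averaged p v w :=
  F.avgInner_apply p v w

end Metric

/-! ### Compatible connections are metrical -/

section Metrical

open Filter Topology

variable {M : Type*} [TopologicalSpace M] [ChartedSpace E3 M] [IsManifold (𝓡 3) ∞ M]

/-- The connection `cov` is metrical with respect to `G`: the metric is parallel. -/
def IsMetrical (G : RMetric M) (cov : Connection M) : Prop :=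
  ∀ Y Z : Π p : M, TangentSpace (𝓡 3) p, SmoothField Y → SmoothField Z →
    ∀ (p : M) (v : TangentSpace (𝓡 3) p),
      mvfderiv (𝓡 3) (fun q => G.inner q (Y q) (Z q)) p v =
        G.inner p (cov Y p v) (Z p) + G.inner p (Y p) (cov Z p v)

lemma mdifferentiableAt_inner (G : RMetric M) {Y Z : Π p : M, TangentSpace (𝓡 3) p} {p : M}
    (hY : MDifferentiableAt (𝓡 3) (𝓡 3).tangent (fun p => (⟨p, Y p⟩ : TangentBundle (𝓡 3) M)) p)
    (hZ : MDifferentiableAt (𝓡 3) (𝓡 3).tangent (fun p => (⟨p, Z p⟩ : TangentBundle (𝓡 3) M)) p) :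
    MDifferentiableAt (𝓡 3) 𝓘(ℝ, ℝ) (fun q => G.inner q (Y q) (Z q)) p := by
  have h := MDifferentiableAt.clm_bundle_apply₂ (E₃ := Bundle.Trivial M ℝ) (F₃ := ℝ)
    ((G.contMDiff p).mdifferentiableAt (by simp)) hY hZ
  exact ((mdifferentiableAt_totalSpace _ _).1 h).2

/-- The defect of metricity at `p` in the direction `v`. -/
def metricDefect (G : RMetric M) (cov : Connection M) (p : M) (v : TangentSpace (𝓡 3) p)
    (Y Z : Π p : M, TangentSpace (𝓡 3) p) : ℝ :=
  mvfderiv (𝓡 3) (fun q => G.inner q (Y q) (Z q)) p v - G.inner p (cov Y p v) (Z p) -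
    G.inner p (Y p) (cov Z p v)

lemma metricDefect_symm (G : RMetric M) (cov : Connection M) (p : M) (v : TangentSpace (𝓡 3) p)
    (Y Z : Π p : M, TangentSpace (𝓡 3) p) :
    metricDefect G cov p v Y Z = metricDefect G cov p v Z Y := by
  have h : (fun q => G.inner q (Y q) (Z q)) = fun q => G.inner q (Z q) (Y q) :=
    funext fun q => G.symm q _ _
  rw [metricDefect, metricDefect, h, G.symm p (cov Y p v), G.symm p (Y p)]
  ring

lemma tensorialAt_metricDefect (G : RMetric M) (cov : Connection M) (p : M)
    (v : TangentSpace (𝓡 3) p) (Z : Π p : M, TangentSpace (𝓡 3) p)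
    (hZ : MDifferentiableAt (𝓡 3) (𝓡 3).tangent (fun p => (⟨p, Z p⟩ : TangentBundle (𝓡 3) M)) p) :
    TensorialAt (𝓡 3) E3 (fun Y => metricDefect G cov p v Y Z) p where
  smul {f Y} hf hY := by
    have h1 : (fun q => G.inner q ((f • Y) q) (Z q)) = fun q => f q * G.inner q (Y q) (Z q) :=
      funext fun q => by simp
    simp only [metricDefect]
    rw [h1, mvfderiv_fun_mul hf (mdifferentiableAt_inner G hY hZ),
      cov.isCovariantDerivativeOnUniv.leibniz hY hf]
    simp
    ring
  add {Y Y'} hY hY' := by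
    have h1 : (fun q => G.inner q ((Y + Y') q) (Z q)) =
        fun q => G.inner q (Y q) (Z q) + G.inner q (Y' q) (Z q) := funext fun q => by simp
    simp only [metricDefect]
    rw [h1, mvfderiv_fun_add (mdifferentiableAt_inner G hY hZ) (mdifferentiableAt_inner G hY' hZ),
      cov.isCovariantDerivativeOnUniv.add hY hY']
    simp
    ring

variable {F : FinslerMetric M} {cov₀ cov : Connection M}

/-- Every compatible connection is metrical with respect to the averaged metric. -/
lemma IsCompatible.isMetrical [T2Space M] (hcomp₀ : IsCompatible F cov₀)
    (hcov₀ : cov₀.ContMDiffCovariantDerivative ∞) (hcomp : IsCompatible F cov)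
    (hcov : cov.ContMDiffCovariantDerivative ∞) :
    IsMetrical (hcomp₀.averagedMetric hcov₀) cov := by
  intro Y Z hY hZ p v
  set G := hcomp₀.averagedMetric hcov₀
  suffices h : metricDefect G cov p v Y Z = 0 by
    rw [metricDefect] at h
    linarith
  -- By tensoriality it suffices to consider coordinate fields.
  have hp := mem_chart_source E3 p
  have hdY := mdifferentiableAt_coordField hp (coords p p (Y p))
  have hdZ := mdifferentiableAt_coordField hp (coords p p (Z p))
  rw [(tensorialAt_metricDefect G cov p v Z (hZ.mdifferentiableAt p)).pointwise
      (hY.mdifferentiableAt p) hdY (coordField_coords hp _).symm, metricDefect_symm,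
    (tensorialAt_metricDefect G cov p v _ hdY).pointwise
      (hZ.mdifferentiableAt p) hdZ (coordField_coords hp _).symm, metricDefect]
  generalize coords p p (Y p) = y
  generalize coords p p (Z p) = z
  have hv : coordField p (coords p p v) p = v := coordField_coords hp v
  have h1 := hasDerivAt_comp_chartLine hp (coords p p v) (mdifferentiableAt_inner G
    (mdifferentiableAt_coordField hp z) (mdifferentiableAt_coordField hp y))
  have h2 := ((hcomp.hasDerivAt_localForm hcov hp (coords p p v)).clm_apply
    (hasDerivAt_const (0 : ℝ) z)).clm_apply (hasDerivAt_const (0 : ℝ) y)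
  have hps : p ∈ (extChartAt (𝓡 3) p).source := by rwa [extChartAt_source]
  have hx : (extChartAt (𝓡 3) p).symm (extChartAt (𝓡 3) p p + (0 : ℝ) • coords p p v) = p := by
    rw [zero_smul, add_zero, (extChartAt (𝓡 3) p).left_inv hps]
  have h3 := h1.unique (h2.congr_of_eventuallyEq (by
    have hc : Continuous fun s : ℝ => extChartAt (𝓡 3) p p + s • coords p p v := by fun_prop
    have := (hc.tendsto 0).eventually ((isOpen_extChartAt_target (I := 𝓡 3) p).mem_nhds
      (by simp))
    filter_upwards [this] with s hs
    have hs' := (extChartAt (𝓡 3) p).map_target hs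
    rw [extChartAt_source] at hs'
    exact (F.localForm_apply hs' z y).symm))
  rw [hv] at h3
  rw [h3, map_zero, map_zero, add_zero, add_apply, zero_apply, add_zero, derivAction_apply,
    F.localForm_apply hp, F.localForm_apply hp, ContinuousLinearMap.flip_apply,
    ContinuousLinearMap.flip_apply, connCoeff_apply cov hp, connCoeff_apply cov hp, hv,
    coordField_coords hp, coordField_coords hp]
  change _ - F.avgInner _ _ _ - F.avgInner _ _ _ = 0
  ring

end Metrical

/-! ### Alternating products on three-dimensional inner product spaces -/

section CrossProduct

variable {V : Type*} [AddCommGroup V] [Module ℝ V]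
  {B : V →ₗ[ℝ] V →ₗ[ℝ] ℝ}

/-- A positive definite symmetric form on a three-dimensional space has an orthonormal basis. -/
lemma exists_orthonormalBasis_form [FiniteDimensional ℝ V] (hV : Module.finrank ℝ V = 3)
    (hsymm : ∀ v w, B v w = B w v)
    (hpos : ∀ v, v ≠ 0 → 0 < B v v) :
    ∃ e : Module.Basis (Fin 3) ℝ V, ∀ i j, B (e i) (e j) = if i = j then 1 else 0 := by
  obtain ⟨b, hb⟩ := LinearMap.BilinForm.exists_orthogonal_basis (B := B) (by
    exact ⟨fun v w => by simpa using hsymm v w⟩)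
  have hn : ∀ i, 0 < B (b i) (b i) := fun i => hpos _ (b.ne_zero i)
  let b' := b.isUnitSMul (w := fun i => (Real.sqrt (B (b i) (b i)))⁻¹)
    fun i => isUnit_iff_ne_zero.2 (inv_ne_zero (Real.sqrt_pos.2 (hn i)).ne')
  refine ⟨b'.reindex (finCongr hV), fun i j => ?_⟩
  generalize hi : (finCongr hV).symm i = i'
  generalize hj : (finCongr hV).symm j = j'
  have hij : i = j ↔ i' = j' := by rw [← hi, ← hj, Equiv.apply_eq_iff_eq]
  simp only [Module.Basis.reindex_apply, hi, hj, hij, b', Module.Basis.isUnitSMul_apply, map_smul,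
    LinearMap.smul_apply, smul_eq_mul]
  split_ifs with h
  · subst h
    have := Real.mul_self_sqrt (hn i').le
    have h0 := (Real.sqrt_pos.2 (hn i')).ne'
    field_simp
    rw [sq, this]
  · rw [hb h]
    simp

lemma form_eq_sum_repr {e : Module.Basis (Fin 3) ℝ V}
    (he : ∀ i j, B (e i) (e j) = if i = j then 1 else 0) (a b : V) :
    B a b = ∑ i, e.repr a i * e.repr b i := by
  conv_lhs => rw [← e.sum_repr a, ← e.sum_repr b]
  simp only [map_sum, map_smul, LinearMap.sum_apply, LinearMap.smul_apply, he, smul_eq_mul,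
    mul_ite, mul_one, mul_zero, Finset.sum_ite_eq', Finset.mem_univ, if_true]
  exact Finset.sum_congr rfl fun i _ => mul_comm _ _

variable {T : V → V → V} {τ : V [⋀^Fin 3]→ₗ[ℝ] ℝ}

/-- If `B (T (a, b), c)` is an alternating 3-form, then `T` is a multiple of the cross product: it
satisfies the Lagrange identity with a factor `κ`, the square of the value of the 3-form on an
orthonormal basis. -/
lemma exists_lagrange_identity [FiniteDimensional ℝ V] (hV : Module.finrank ℝ V = 3)
    (hsymm : ∀ v w, B v w = B w v)
    (hpos : ∀ v, v ≠ 0 → 0 < B v v) (hτ : ∀ a b c, B (T a b) c = τ ![a, b, c]) :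
    ∃ κ : ℝ, 0 ≤ κ ∧ (∀ a b a' b', B (T a b) (T a' b') =
        κ * (B a a' * B b b' - B a b' * B b a')) ∧
      ∀ v : Fin 3 → V, τ v ^ 2 = κ * (Matrix.of fun i j => B (v i) (v j)).det := by
  obtain ⟨e, he⟩ := exists_orthonormalBasis_form hV hsymm hpos
  set f := τ e with hf
  have hdet : τ = f • e.det := τ.eq_smul_basis_det e
  have hB := form_eq_sum_repr he
  have hcoord : ∀ a k, e.repr a k = B a (e k) := by
    intro a k
    simp [hB, Finsupp.single_apply]
  refine ⟨f ^ 2, sq_nonneg f, fun a b a' b' => ?_, fun v => ?_⟩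
  · have h : ∀ a b k, e.repr (T a b) k = f * e.det ![a, b, e k] := by
      intro a b k
      rw [hcoord, hτ, hdet]
      rfl
    simp only [hB (T a b), h, hB a, hB b, Module.Basis.det_apply, Matrix.det_fin_three,
      Module.Basis.toMatrix_apply, Fin.sum_univ_three]
    simp
    ring
  · have hM : (Matrix.of fun i j => B (v i) (v j)) = (e.toMatrix v).transpose * e.toMatrix v := by
      ext i j
      simp [hB, Matrix.mul_apply, Module.Basis.toMatrix_apply]
    rw [hM, Matrix.det_mul, Matrix.det_transpose, hdet, AlternatingMap.smul_apply,
      Module.Basis.det_apply]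
    simp only [smul_eq_mul]
    ring

/-- The Gram determinant of a basis is positive. -/
lemma gram_det_pos [FiniteDimensional ℝ V] (hV : Module.finrank ℝ V = 3)
    (hsymm : ∀ v w, B v w = B w v)
    (hpos : ∀ v, v ≠ 0 → 0 < B v v) (v : Module.Basis (Fin 3) ℝ V) :
    0 < (Matrix.of fun i j => B (v i) (v j)).det := by
  obtain ⟨e, he⟩ := exists_orthonormalBasis_form hV hsymm hpos
  have hB := form_eq_sum_repr he
  have hM : (Matrix.of fun i j => B (v i) (v j)) = (e.toMatrix v).transpose * e.toMatrix v := by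
    ext i j
    simp [hB, Matrix.mul_apply, Module.Basis.toMatrix_apply]
  rw [hM, Matrix.det_mul, Matrix.det_transpose, ← Module.Basis.det_apply]
  exact mul_self_pos.2 (e.isUnit_det v).ne_zero

end CrossProduct

/-! ### Flat metrical connections with totally anti-symmetric torsion -/

section Torsion

open Filter Topology VectorField

variable {M : Type*} [TopologicalSpace M] [ChartedSpace E3 M] [IsManifold (𝓡 3) ∞ M]
  {X Y Z W : Π p : M, TangentSpace (𝓡 3) p}

lemma SmoothField.mlieBracket (hX : SmoothField X) (hY : SmoothField Y) :
    SmoothField (mlieBracket (𝓡 3) X Y) := fun p =>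
  have : IsManifold (𝓡 3) (((⊤ : ℕ∞) : WithTop ℕ∞) + 1) M :=
    inferInstanceAs (IsManifold (𝓡 3) ∞ M)
  have : IsManifold (𝓡 3) (minSmoothness ℝ 2) M := by
    rw [minSmoothness_of_isRCLikeNormedField]
    exact IsManifold.of_le (n := ∞) (WithTop.coe_le_coe.2 le_top)
  ContMDiffAt.mlieBracket_vectorField (m := ⊤) (n := ⊤) (hX p) (hY p)
    (by rw [minSmoothness_of_isRCLikeNormedField]; rfl)

/-- The torsion of two vector fields. -/
def torsionField (cov : Connection M) (X Y : Π p : M, TangentSpace (𝓡 3) p) :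
    Π p : M, TangentSpace (𝓡 3) p := fun p => cov.torsion p (X p) (Y p)

variable {cov : Connection M}

lemma torsionField_apply (hX : SmoothField X) (hY : SmoothField Y) (p : M) :
    torsionField cov X Y p = cov Y p (X p) - cov X p (Y p) - mlieBracket (𝓡 3) X Y p :=
  cov.torsion_apply (hX.mdifferentiableAt p) (hY.mdifferentiableAt p)

lemma SmoothField.sub (hX : SmoothField X) (hY : SmoothField Y) :
    SmoothField fun p => X p - Y p :=
  ContMDiff.sub_section hX hY

lemma SmoothField.torsionField (hcov : cov.ContMDiffCovariantDerivative ∞) (hX : SmoothField X)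
    (hY : SmoothField Y) : SmoothField (torsionField cov X Y) := by
  have h : FinslerThree.torsionField cov X Y =
      fun p => cov Y p (X p) - cov X p (Y p) - VectorField.mlieBracket (𝓡 3) X Y p :=
    funext fun p => torsionField_apply hX hY p
  rw [h]
  exact ((hX.cov hcov hY).sub (hY.cov hcov hX)).sub (hX.mlieBracket hY)

/-- The covariant derivative `(∇_X T)(Y, Z)` of the torsion. -/
def torsionDeriv (cov : Connection M) (X Y Z : Π p : M, TangentSpace (𝓡 3) p) (p : M) :
    TangentSpace (𝓡 3) p :=
  cov (torsionField cov Y Z) p (X p) - cov.torsion p (cov Y p (X p)) (Z p) -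
    cov.torsion p (Y p) (cov Z p (X p))

lemma cov_sub (hX : SmoothField X) (hY : SmoothField Y) (p : M) :
    cov (fun q => X q - Y q) p = cov X p - cov Y p := by
  have h : (fun q => X q - Y q) + Y = X := funext fun q => sub_add_cancel _ _
  have h1 := cov.isCovariantDerivativeOnUniv.add ((hX.sub hY).mdifferentiableAt p)
    (hY.mdifferentiableAt p)
  rw [h] at h1
  rw [h1, add_sub_cancel_right]

lemma torsionDeriv_swap (hcov : cov.ContMDiffCovariantDerivative ∞) (hY : SmoothField Y)
    (hZ : SmoothField Z) (p : M) :
    torsionDeriv cov X Y Z p = -torsionDeriv cov X Z Y p := by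
  have h0 : torsionField cov Z Z = fun p => (0 : TangentSpace (𝓡 3) p) :=
    funext fun q => cov.torsion_self _
  have h : torsionField cov Y Z =
      fun q => torsionField cov Z Z q - torsionField cov Z Y q := by
    funext q
    rw [h0, zero_sub]
    exact cov.torsion_antisymm _ _
  have hz : cov (torsionField cov Z Z) p = 0 := by
    rw [h0]
    exact cov.isCovariantDerivativeOnUniv.zero
  rw [torsionDeriv, torsionDeriv, h, cov_sub (hZ.torsionField hcov hZ) (hZ.torsionField hcov hY),
    hz, cov.torsion_antisymm (cov Y p (X p)), cov.torsion_antisymm (Y p)]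
  simp only [zero_sub, neg_apply]
  module

/-- The Jacobi identity in cyclic form. -/
lemma jacobi_mlieBracket (hX : SmoothField X) (hY : SmoothField Y) (hZ : SmoothField Z) (p : M) :
    mlieBracket (𝓡 3) X (mlieBracket (𝓡 3) Y Z) p + mlieBracket (𝓡 3) Y (mlieBracket (𝓡 3) Z X) p +
      mlieBracket (𝓡 3) Z (mlieBracket (𝓡 3) X Y) p = 0 := by
  have h2 : minSmoothness ℝ 2 ≤ ∞ := by
    rw [minSmoothness_of_isRCLikeNormedField]
    exact WithTop.coe_le_coe.2 le_top
  have : IsManifold (𝓡 3) (minSmoothness ℝ 3) M := by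
    rw [minSmoothness_of_isRCLikeNormedField]
    exact IsManifold.of_le (n := ∞) (WithTop.coe_le_coe.2 le_top)
  have h := leibniz_identity_mlieBracket_apply ((hX p).of_le h2) ((hY p).of_le h2)
    ((hZ p).of_le h2)
  have h3 : mlieBracket (𝓡 3) Y (mlieBracket (𝓡 3) Z X) p =
      -mlieBracket (𝓡 3) Y (mlieBracket (𝓡 3) X Z) p := by
    rw [mlieBracket_swap (V := Z) (W := X)]
    have := mlieBracket_const_smul_right (I := 𝓡 3) (V := Y) (c := (-1 : ℝ))
      ((hX.mlieBracket hZ).mdifferentiableAt p)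
    simpa using this
  rw [h, h3, mlieBracket_swap_apply (V := mlieBracket (𝓡 3) X Y)]
  module

lemma cov_torsionField (hcov : cov.ContMDiffCovariantDerivative ∞) (hX : SmoothField X)
    (hY : SmoothField Y) (p : M) (v : TangentSpace (𝓡 3) p) :
    cov (torsionField cov X Y) p v = cov (fun q => cov Y q (X q)) p v -
      cov (fun q => cov X q (Y q)) p v - cov (mlieBracket (𝓡 3) X Y) p v := by
  have h : torsionField cov X Y =
      fun p => cov Y p (X p) - cov X p (Y p) - mlieBracket (𝓡 3) X Y p :=
    funext fun p => torsionField_apply hX hY p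
  rw [h, cov_sub ((hX.cov hcov hY).sub (hY.cov hcov hX)) (hX.mlieBracket hY),
    cov_sub (hX.cov hcov hY) (hY.cov hcov hX)]
  rfl

/-- The first Bianchi identity of a flat connection. -/
lemma bianchi_of_isFlat (hcov : cov.ContMDiffCovariantDerivative ∞) (hflat : IsFlat cov)
    (hX : SmoothField X) (hY : SmoothField Y) (hZ : SmoothField Z) (p : M) :
    torsionDeriv cov X Y Z p + torsionDeriv cov Y Z X p + torsionDeriv cov Z X Y p =
      -(cov.torsion p (cov.torsion p (X p) (Y p)) (Z p) +
        cov.torsion p (cov.torsion p (Y p) (Z p)) (X p) +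
        cov.torsion p (cov.torsion p (Z p) (X p)) (Y p)) := by
  have hTT : ∀ {X Y Z : Π p : M, TangentSpace (𝓡 3) p}, SmoothField X → SmoothField Y →
      SmoothField Z → cov.torsion p (cov.torsion p (X p) (Y p)) (Z p) =
        cov.torsion p (cov Y p (X p)) (Z p) + cov.torsion p (Z p) (cov X p (Y p)) -
          (cov Z p (mlieBracket (𝓡 3) X Y p) - cov (mlieBracket (𝓡 3) X Y) p (Z p) +
            mlieBracket (𝓡 3) Z (mlieBracket (𝓡 3) X Y) p) := by
    intro X Y Z hX hY hZ
    have h1 := torsionField_apply (cov := cov) hX hY p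
    have h2 := torsionField_apply (cov := cov) (hX.mlieBracket hY) hZ p
    rw [mlieBracket_swap_apply (V := mlieBracket (𝓡 3) X Y)] at h2
    rw [torsionField] at h1 h2
    rw [h1, map_sub, map_sub, sub_apply, sub_apply, h2, cov.torsion_antisymm (Z p)]
    module
  have f1 := hflat X Y Z hX hY hZ p
  have f2 := hflat Y Z X hY hZ hX p
  have f3 := hflat Z X Y hZ hX hY p
  have j := jacobi_mlieBracket hX hY hZ p
  rw [curvature] at f1 f2 f3
  rw [hTT hX hY hZ, hTT hY hZ hX, hTT hZ hX hY, torsionDeriv, torsionDeriv, torsionDeriv,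
    cov_torsionField hcov hY hZ, cov_torsionField hcov hZ hX, cov_torsionField hcov hX hY]
  linear_combination (norm := module) f1 + f2 + f3 - j

variable {G : RMetric M}

/-- `G (T (X, Y), Z)` is skew in the last two arguments; as it is skew in the first two anyway, this
means that it is alternating. -/
def IsSkewTorsion (G : RMetric M) (cov : Connection M) : Prop :=
  ∀ (p : M) (u v w : TangentSpace (𝓡 3) p),
    G.inner p (cov.torsion p u v) w = -G.inner p (cov.torsion p u w) v

lemma IsSkewTorsion.cyc (hT : IsSkewTorsion G cov) (p : M) (u v w : TangentSpace (𝓡 3) p) :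
    G.inner p (cov.torsion p u v) w = G.inner p (cov.torsion p v w) u := by
  rw [cov.torsion_antisymm, map_neg, neg_apply, hT, neg_neg]

/-- As the metric is parallel, `∇_X T` inherits the skew symmetry of `T`. -/
lemma inner_torsionDeriv_swap (hmet : IsMetrical G cov) (hT : IsSkewTorsion G cov)
    (hcov : cov.ContMDiffCovariantDerivative ∞)
    (hY : SmoothField Y) (hZ : SmoothField Z) (hW : SmoothField W) (p : M) :
    G.inner p (torsionDeriv cov X Y Z p) (W p) = -G.inner p (torsionDeriv cov X Y W p) (Z p) := by
  have hz : (fun q => G.inner q (torsionField cov Y Z q) (W q)) =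
      fun q => -G.inner q (torsionField cov Y W q) (Z q) := funext fun q => hT q _ _ _
  have h1 := hmet _ _ (hY.torsionField hcov hZ) hW p (X p)
  have h2 := hmet _ _ (hY.torsionField hcov hW) hZ p (X p)
  rw [hz, mvfderiv_fun_neg, neg_apply, h2] at h1
  simp only [torsionDeriv, map_sub, sub_apply, torsionField] at h1 ⊢
  have e1 := hT p (cov Y p (X p)) (Z p) (W p)
  have e2 := hT p (Y p) (cov Z p (X p)) (W p)
  have e3 := hT p (Y p) (Z p) (cov W p (X p))
  linarith

/-- A part of the parallelism of the torsion: the inner product of the Bianchi identity with `X`. -/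
lemma inner_torsionDeriv_eq_zero (hmet : IsMetrical G cov) (hT : IsSkewTorsion G cov)
    (hcov : cov.ContMDiffCovariantDerivative ∞) (hflat : IsFlat cov)
    (hX : SmoothField X) (hY : SmoothField Y) (hZ : SmoothField Z) (p : M) :
    G.inner p (torsionDeriv cov X Y X p) (Z p) = 0 := by
  have hb := congrArg (fun u => G.inner p u (X p)) (bianchi_of_isFlat hcov hflat hX hY hZ p)
  simp only [map_add, map_neg, add_apply, neg_apply] at hb
  have s1 := inner_torsionDeriv_swap (X := X) hmet hT hcov hY hZ hX p
  have s2 := inner_torsionDeriv_swap (X := Y) hmet hT hcov hZ hX hX p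
  have s3 := inner_torsionDeriv_swap (X := Z) hmet hT hcov hX hY hX p
  have s4 : G.inner p (torsionDeriv cov Z X X p) (Y p) = 0 := by
    have := congrArg (fun u => G.inner p u (Y p)) (torsionDeriv_swap (X := Z) hcov hX hX p)
    simp only [map_neg, neg_apply] at this
    linarith
  have t1 : G.inner p (cov.torsion p (cov.torsion p (X p) (Y p)) (Z p)) (X p) =
      G.inner p (cov.torsion p (Z p) (X p)) (cov.torsion p (X p) (Y p)) := hT.cyc ..
  have t2 : G.inner p (cov.torsion p (cov.torsion p (Y p) (Z p)) (X p)) (X p) = 0 := by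
    rw [hT.cyc, cov.torsion_self, map_zero, zero_apply]
  have t3 : G.inner p (cov.torsion p (cov.torsion p (Z p) (X p)) (Y p)) (X p) =
      -G.inner p (cov.torsion p (Z p) (X p)) (cov.torsion p (X p) (Y p)) := by
    rw [hT.cyc, cov.torsion_antisymm, map_neg, neg_apply, G.symm]
  linarith

end Torsion

/-! ### Constancy of the torsion factor -/

section Constancy

open Filter Topology VectorField

/-- The strict Cauchy-Schwarz inequality. -/
lemma gram_pos {V : Type*} [AddCommGroup V] [Module ℝ V] {B : V →ₗ[ℝ] V →ₗ[ℝ] ℝ}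
    (hsymm : ∀ v w, B v w = B w v) (hpos : ∀ v, v ≠ 0 → 0 < B v v) {v w : V}
    (h : LinearIndependent ℝ ![v, w]) : 0 < B v v * B w w - B v w ^ 2 := by
  have hv : v ≠ 0 := h.ne_zero 0
  have h0 := hpos v hv
  have hu : w - (B v w / B v v) • v ≠ 0 := by
    intro hu
    have := LinearIndependent.pair_iff.1 h (-(B v w / B v v)) 1 (by rw [← hu]; module)
    exact one_ne_zero this.2
  have h1 := hpos _ hu
  have h2 : B v v * B (w - (B v w / B v v) • v) (w - (B v w / B v v) • v) =
      B v v * B w w - B v w ^ 2 := by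
    simp only [map_sub, map_smul, LinearMap.sub_apply, LinearMap.smul_apply, smul_eq_mul,
      hsymm w v]
    field_simp
    ring
  rw [← h2]
  positivity

variable {M : Type*} [TopologicalSpace M] [ChartedSpace E3 M] [IsManifold (𝓡 3) ∞ M]

/-- A function with vanishing differential on a connected manifold is constant. -/
lemma eq_of_mvfderiv_eq_zero [ConnectedSpace M] {f : M → ℝ}
    (hf : ∀ p, MDifferentiableAt (𝓡 3) 𝓘(ℝ, ℝ) f p)
    (hf' : ∀ p v, mvfderiv (𝓡 3) f p v = 0) (p q : M) : f p = f q := by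
  have hloc : IsLocallyConstant f := by
    rw [IsLocallyConstant.iff_eventually_eq]
    intro p
    set φ := extChartAt (𝓡 3) p with hφ
    have hopen : IsOpen φ.target := isOpen_extChartAt_target p
    have hd : ∀ x ∈ φ.target, HasFDerivAt (f ∘ φ.symm) (0 : E3 →L[ℝ] ℝ) x := by
      intro x hx
      -- A total differential equation with coefficients zero.
      have h := hasFDerivAt_of_totalDifferential (h := f ∘ φ.symm) (L := fun _ => 0) hopen
        continuousOn_const (fun x hx v => by
          have hsrc : φ.symm x ∈ (chartAt E3 p).source := by
            simpa [hφ, extChartAt_source] using φ.map_target hx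
          have h1 := hasDerivAt_comp_chartLine hsrc v (hf (φ.symm x))
          rw [hf', ← hφ, φ.right_inv hx] at h1
          simpa using h1) hx
      refine h.congr_fderiv ?_
      ext v
      simp
    obtain ⟨r, hr, hball⟩ := Metric.isOpen_iff.1 hopen (φ p) (mem_extChartAt_target p)
    have hc : ∀ x ∈ Metric.ball (φ p) r, (f ∘ φ.symm) x = (f ∘ φ.symm) (φ p) := fun x hx =>
      Metric.isOpen_ball.is_const_of_fderiv_eq_zero (𝕜 := ℝ)
        (convex_ball _ _).isPreconnected
        (fun y hy => (hd y (hball hy)).differentiableAt.differentiableWithinAt)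
        (fun y hy => (hd y (hball hy)).fderiv) hx (Metric.mem_ball_self hr)
    have hcont := (continuousAt_extChartAt (I := 𝓡 3) p).eventually
      (Metric.isOpen_ball.mem_nhds (Metric.mem_ball_self hr))
    filter_upwards [hcont, (chartAt E3 p).open_source.mem_nhds (mem_chart_source E3 p)]
      with q hq hqs
    have := hc _ hq
    simp only [Function.comp] at this
    rwa [φ.left_inv (by rwa [hφ, extChartAt_source]),
      φ.left_inv (mem_extChartAt_source p)] at this
  exact hloc.apply_eq_of_preconnectedSpace p q

variable {cov : Connection M} {G : RMetric M}

instance (p : M) : FiniteDimensional ℝ (TangentSpace (𝓡 3) p) :=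
  inferInstanceAs (FiniteDimensional ℝ E3)

lemma finrank_tangentSpace {M : Type*} [TopologicalSpace M] [ChartedSpace E3 M] (p : M) :
    Module.finrank ℝ (TangentSpace (𝓡 3) p) = 3 :=
  (finrank_euclideanSpace_fin : Module.finrank ℝ E3 = 3)

lemma inner_gram_pos (G : RMetric M) {p : M} {v w : TangentSpace (𝓡 3) p}
    (h : LinearIndependent ℝ ![v, w]) :
    0 < G.inner p v v * G.inner p w w - G.inner p v w ^ 2 :=
  gram_pos (B := (G.inner p).toLinearMap₁₂) (G.symm p) (G.pos p) h

/-- `κ` is the factor in the Lagrange identity of the torsion. -/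
def IsTorsionFactor (G : RMetric M) (cov : Connection M) (κ : M → ℝ) : Prop :=
  ∀ (p : M) (a b a' b' : TangentSpace (𝓡 3) p),
    G.inner p (cov.torsion p a b) (cov.torsion p a' b') =
      κ p * (G.inner p a a' * G.inner p b b' - G.inner p a b' * G.inner p b a')

/-- The factor is constant: it is the quotient of `|T (Y, X)|²` and the Gram determinant of `Y, X`,
and both have proportional derivatives in the direction `X`. -/
lemma IsTorsionFactor.eq [T2Space M] [ConnectedSpace M] {κ : M → ℝ}
    (hκ : IsTorsionFactor G cov κ) (hmet : IsMetrical G cov)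
    (hT : IsSkewTorsion G cov) (hcov : cov.ContMDiffCovariantDerivative ∞) (hflat : IsFlat cov)
    (p q : M) : κ p = κ q := by
  have key : ∀ (p : M) (v : TangentSpace (𝓡 3) p), v ≠ 0 →
      MDifferentiableAt (𝓡 3) 𝓘(ℝ, ℝ) κ p ∧ mvfderiv (𝓡 3) κ p v = 0 := by
    intro p v hv
    obtain ⟨w, hw⟩ := exists_linearIndependent_pair_of_one_lt_finrank
      (by rw [finrank_tangentSpace]; norm_num) hv
    obtain ⟨X, hX, rfl⟩ := exists_smoothField_eq p v
    obtain ⟨Y, hY, rfl⟩ := exists_smoothField_eq p w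
    have hS := hY.torsionField hcov hX
    have hdiff : ∀ {A B : Π p : M, TangentSpace (𝓡 3) p}, SmoothField A → SmoothField B →
        MDifferentiableAt (𝓡 3) 𝓘(ℝ, ℝ) (fun q => G.inner q (A q) (B q)) p := fun hA hB =>
      mdifferentiableAt_inner G (hA.mdifferentiableAt p) (hB.mdifferentiableAt p)
    set N : M → ℝ := fun q => G.inner q (torsionField cov Y X q) (torsionField cov Y X q) with hN
    set D : M → ℝ := fun q => G.inner q (Y q) (Y q) * G.inner q (X q) (X q) -
      G.inner q (Y q) (X q) * G.inner q (Y q) (X q) with hD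
    have hND : N = fun q => κ q * D q := by
      funext q
      simp only [hN, hD, torsionField]
      rw [hκ, G.symm q (X q) (Y q)]
    have hDd : MDifferentiableAt (𝓡 3) 𝓘(ℝ, ℝ) D p :=
      ((hdiff hY hY).mul (hdiff hX hX)).sub ((hdiff hY hX).mul (hdiff hY hX))
    have hNd : MDifferentiableAt (𝓡 3) 𝓘(ℝ, ℝ) N p := hdiff hS hS
    have hD0 : D p ≠ 0 := by
      have h := inner_gram_pos G hw
      rw [G.symm p (X p) (Y p)] at h
      simp only [hD]
      nlinarith
    have hκd : MDifferentiableAt (𝓡 3) 𝓘(ℝ, ℝ) κ p := by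
      have h1 : MDifferentiableAt (𝓡 3) 𝓘(ℝ, ℝ) (fun q => N q * (D q)⁻¹) p :=
        hNd.mul ((differentiableAt_inv hD0).mdifferentiableAt.comp p hDd)
      refine h1.congr_of_eventuallyEq ?_
      filter_upwards [hDd.continuousAt.eventually_ne hD0] with q hq
      rw [hND]
      field_simp
    refine ⟨hκd, ?_⟩
    have h1 : mvfderiv (𝓡 3) N p (X p) =
        κ p * mvfderiv (𝓡 3) D p (X p) + D p * mvfderiv (𝓡 3) κ p (X p) := by
      rw [hND, mvfderiv_fun_mul hκd hDd]
      simp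
    have h2 : mvfderiv (𝓡 3) D p (X p) =
        2 * G.inner p (cov Y p (X p)) (Y p) * G.inner p (X p) (X p) +
          2 * G.inner p (Y p) (Y p) * G.inner p (cov X p (X p)) (X p) -
          2 * G.inner p (Y p) (X p) * (G.inner p (cov Y p (X p)) (X p) +
            G.inner p (Y p) (cov X p (X p))) := by
      have hD' : D = (fun q => G.inner q (Y q) (Y q)) * (fun q => G.inner q (X q) (X q)) -
        (fun q => G.inner q (Y q) (X q)) * fun q => G.inner q (Y q) (X q) := rfl
      rw [hD', mvfderiv_sub ((hdiff hY hY).mul (hdiff hX hX)) ((hdiff hY hX).mul (hdiff hY hX)),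
        mvfderiv_mul (hdiff hY hY) (hdiff hX hX), mvfderiv_mul (hdiff hY hX) (hdiff hY hX)]
      simp only [sub_apply, add_apply, smul_apply, smul_eq_mul, hmet Y Y hY hY, hmet X X hX hX,
        hmet Y X hY hX]
      rw [G.symm p (Y p) (cov Y p (X p)), G.symm p (X p) (cov X p (X p))]
      ring
    have h3 : mvfderiv (𝓡 3) N p (X p) = κ p * mvfderiv (𝓡 3) D p (X p) := by
      have h4 := inner_torsionDeriv_eq_zero hmet hT hcov hflat hX hY hS p
      rw [h2]
      simp only [hN]
      rw [hmet _ _ hS hS, G.symm p (torsionField cov Y X p)]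
      simp only [torsionDeriv, map_sub, sub_apply] at h4
      have h5 := hκ p (cov Y p (X p)) (X p) (Y p) (X p)
      have h6 := hκ p (Y p) (cov X p (X p)) (Y p) (X p)
      rw [G.symm p (X p) (Y p)] at h5
      rw [G.symm p (cov X p (X p)) (Y p)] at h6
      simp only [torsionField] at h4 ⊢
      linear_combination 2 * h4 + 2 * h5 + 2 * h6
    have h4 : D p * mvfderiv (𝓡 3) κ p (X p) = 0 := by linarith
    exact (mul_eq_zero.1 h4).resolve_left hD0
  refine eq_of_mvfderiv_eq_zero (fun p => ?_) (fun p v => ?_) p q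
  · have : Nontrivial (TangentSpace (𝓡 3) p) :=
      Module.nontrivial_of_finrank_pos (R := ℝ) (by rw [finrank_tangentSpace]; norm_num)
    obtain ⟨v, hv⟩ := exists_ne (0 : TangentSpace (𝓡 3) p)
    exact (key p v hv).1
  · rcases eq_or_ne v 0 with rfl | hv
    · exact map_zero _
    · exact (key p v hv).2

end Constancy

/-! ### The Levi-Civita connection -/

section LeviCivita

open Filter Topology VectorField

variable {M : Type*} [TopologicalSpace M] [ChartedSpace E3 M] [IsManifold (𝓡 3) ∞ M]

/-- A field of endomorphisms of the tangent spaces is smooth if it maps smooth vector fields to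
smooth vector fields. -/
lemma contMDiff_endomorphism [T2Space M]
    {S : Π p : M, TangentSpace (𝓡 3) p →L[ℝ] TangentSpace (𝓡 3) p}
    (hS : ∀ X : Π p : M, TangentSpace (𝓡 3) p, SmoothField X → SmoothField fun p => S p (X p)) :
    ContMDiff (𝓡 3) ((𝓡 3).prod 𝓘(ℝ, E3 →L[ℝ] E3)) ∞
      (fun p => (⟨p, S p⟩ : Bundle.TotalSpace (E3 →L[ℝ] E3)
        fun x : M => TangentSpace (𝓡 3) x →L[ℝ] TangentSpace (𝓡 3) x)) := by
  intro p
  rw [contMDiffAt_hom_bundle]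
  refine ⟨contMDiffAt_id, ?_⟩
  have hp := mem_chart_source E3 p
  have h1 : ∀ i, ContMDiffAt (𝓡 3) 𝓘(ℝ, E3) ∞
      (fun q => coords p q (S q (coordField p (stdVec i) q))) p := by
    intro i
    refine contMDiffAt_coords hp ?_
    obtain ⟨X, hX, hXe⟩ := exists_smoothField_coordField hp (stdVec i)
    refine (hS X hX p).congr_of_eventuallyEq ?_
    filter_upwards [hXe] with q hq
    rw [hq]
  have h2 : ContMDiffAt (𝓡 3) 𝓘(ℝ, E3 →L[ℝ] E3) ∞ (fun q => ∑ i : Fin 3,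
      ContinuousLinearMap.smulRightL ℝ E3 E3 (EuclideanSpace.proj i)
        (coords p q (S q (coordField p (stdVec i) q)))) p :=
    ContMDiffAt.sum fun i _ => (ContinuousLinearMap.contMDiff _).contMDiffAt.comp p (h1 i)
  refine h2.congr_of_eventuallyEq ?_
  filter_upwards [(chartAt E3 p).open_source.mem_nhds hp] with q hq
  have hq' : q ∈ (trivializationAt E3 (TangentSpace (𝓡 3) : M → Type _) p).baseSet := by
    simpa using hq
  rw [ContinuousLinearMap.inCoordinates_eq hq' hq']
  ext1 v
  have h3 : ∀ w, coords p q w = (frameEquiv p q hq).symm w := fun w =>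
    (frameEquiv_symm_apply hq w).symm
  have h4 : ∀ v, coordField p v q = frameEquiv p q hq v := fun v => rfl
  simp only [h3, h4]
  change (frameEquiv p q hq).symm (S q (frameEquiv p q hq v)) = _
  conv_lhs => rw [IsMinkowski.eq_sum_stdVec v]
  simp only [map_sum, map_smul, sum_apply]
  rfl

/-- The connection `∇ - T / 2`, that is `∇_v Y - T(v, Y) / 2 = ∇_v Y + T(Y, v) / 2`. -/
def symmetrization (cov : Connection M) : Connection M :=
  cov.addOneForm fun p => (1 / 2 : ℝ) • cov.torsion p

variable {cov : Connection M} {G : RMetric M} {X Y : Π p : M, TangentSpace (𝓡 3) p}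

lemma symmetrization_apply (cov : Connection M) (Y : Π p : M, TangentSpace (𝓡 3) p) (p : M)
    (v : TangentSpace (𝓡 3) p) :
    symmetrization cov Y p v = cov Y p v + (1 / 2 : ℝ) • cov.torsion p (Y p) v := rfl

lemma SmoothField.add (hX : SmoothField X) (hY : SmoothField Y) :
    SmoothField fun p => X p + Y p :=
  ContMDiff.add_section hX hY

lemma SmoothField.const_smul (c : ℝ) (hX : SmoothField X) : SmoothField fun p => c • X p :=
  ContMDiff.const_smul_section hX

lemma contMDiff_symmetrization [T2Space M] (hcov : cov.ContMDiffCovariantDerivative ∞) :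
    (symmetrization cov).ContMDiffCovariantDerivative ∞ := by
  refine ⟨⟨fun {Y} hY => ?_⟩⟩
  have hY : SmoothField Y := contMDiffOn_univ.1 hY
  refine ContMDiff.contMDiffOn (contMDiff_endomorphism (S := symmetrization cov Y) fun X hX => ?_)
  exact (hX.cov hcov hY).add ((hY.torsionField hcov hX).const_smul (1 / 2))

lemma torsion_symmetrization (cov : Connection M) : (symmetrization cov).torsion = 0 := by
  rw [CovariantDerivative.torsion_eq_zero_iff]
  intro X Y p hX hY
  have h := cov.torsion_apply hX hY
  rw [symmetrization_apply, symmetrization_apply, cov.torsion_antisymm (Y p), h]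
  module

/-- The symmetrization of a metrical connection with totally anti-symmetric torsion is the
Levi-Civita connection. -/
lemma isLeviCivita_symmetrization [T2Space M] (hmet : IsMetrical G cov) (hT : IsSkewTorsion G cov)
    (hcov : cov.ContMDiffCovariantDerivative ∞) : IsLeviCivita G (symmetrization cov) where
  smooth := contMDiff_symmetrization hcov
  torsion_eq_zero := torsion_symmetrization cov
  metrical Y Z hY hZ p v := by
    have e1 := hT.cyc p (Y p) v (Z p)
    have e2 : G.inner p (Y p) (cov.torsion p (Z p) v) =
        -G.inner p (cov.torsion p v (Z p)) (Y p) := by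
      rw [G.symm, cov.torsion_antisymm, map_neg, neg_apply]
    rw [hmet Y Z hY hZ, symmetrization_apply, symmetrization_apply]
    simp only [map_add, map_smul, add_apply, smul_apply, smul_eq_mul, e1, e2]
    ring

lemma cov_const_smul (cov : Connection M) (c : ℝ) (hX : SmoothField X) (p : M) :
    cov (fun q => c • X q) p = c • cov X p :=
  cov.isCovariantDerivativeOnUniv.smul_const c (hX.mdifferentiableAt p)

lemma cov_add (hX : SmoothField X) (hY : SmoothField Y) (p : M) :
    cov (fun q => X q + Y q) p = cov X p + cov Y p :=
  cov.isCovariantDerivativeOnUniv.add (hX.mdifferentiableAt p) (hY.mdifferentiableAt p)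

/-- The curvature of the Levi-Civita connection in terms of the flat connection. -/
lemma curvature_symmetrization (hcov : cov.ContMDiffCovariantDerivative ∞) (hflat : IsFlat cov)
    (hX : SmoothField X) (hY : SmoothField Y) (p : M) :
    curvature (symmetrization cov) X Y Y p = (1 / 2 : ℝ) • torsionDeriv cov Y X Y p -
      (1 / 4 : ℝ) • cov.torsion p (cov.torsion p (X p) (Y p)) (Y p) := by
  have h1 : (fun q => symmetrization cov Y q (Y q)) = fun q => cov Y q (Y q) := by
    funext q
    rw [symmetrization_apply, cov.torsion_self, smul_zero, add_zero]
  have h2 : (fun q => symmetrization cov Y q (X q)) =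
      fun q => cov Y q (X q) + (-(1 / 2) : ℝ) • torsionField cov X Y q := by
    funext q
    rw [symmetrization_apply, cov.torsion_antisymm, torsionField]
    module
  have hS := hX.torsionField hcov hY
  have f := hflat X Y Y hX hY hY p
  have t := torsionField_apply (cov := cov) hX hY p
  rw [curvature] at f
  have t' : mlieBracket (𝓡 3) X Y p =
      cov Y p (X p) - cov X p (Y p) - cov.torsion p (X p) (Y p) := by
    rw [torsionField] at t
    rw [t]
    module
  rw [curvature, h1, h2, symmetrization_apply, symmetrization_apply, symmetrization_apply,
    cov_add (hX.cov hcov hY) (hS.const_smul _), cov_const_smul cov _ hS, torsionDeriv]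
  rw [t'] at f ⊢
  have e1 := cov.torsion_antisymm (cov Y p (Y p)) (X p)
  have e2 := cov.torsion_antisymm (Y p) (cov Y p (X p) - cov X p (Y p) - cov.torsion p (X p) (Y p))
  rw [e1, e2]
  simp only [map_add, map_sub, map_smul, add_apply, sub_apply, smul_apply, torsionField] at f ⊢
  linear_combination (norm := module) f

/-- A flat metrical connection with totally anti-symmetric torsion forces constant curvature. -/
lemma sectionalCurvature_symmetrization {κ : M → ℝ} (hκ : IsTorsionFactor G cov κ)
    (hmet : IsMetrical G cov) (hT : IsSkewTorsion G cov)
    (hcov : cov.ContMDiffCovariantDerivative ∞) (hflat : IsFlat cov) (hX : SmoothField X)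
    (hY : SmoothField Y) {p : M} (h : LinearIndependent ℝ ![X p, Y p]) :
    sectionalCurvature G (symmetrization cov) X Y p = κ p / 4 := by
  have h0 := inner_gram_pos G h
  have h1 : G.inner p (torsionDeriv cov Y X Y p) (X p) = 0 := by
    have e1 := inner_torsionDeriv_swap (X := Y) hmet hT hcov hY hX hX p
    have e2 := congrArg (fun u => G.inner p u (X p)) (torsionDeriv_swap (X := Y) hcov hX hY p)
    simp only [map_neg, neg_apply] at e2
    linarith
  have h2 : G.inner p (cov.torsion p (cov.torsion p (X p) (Y p)) (Y p)) (X p) =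
      -(κ p * (G.inner p (X p) (X p) * G.inner p (Y p) (Y p) - G.inner p (X p) (Y p) ^ 2)) := by
    rw [hT.cyc, cov.torsion_antisymm, map_neg, neg_apply, hκ, G.symm p (Y p) (X p)]
    ring
  rw [sectionalCurvature, curvature_symmetrization hcov hflat hX hY, div_eq_iff h0.ne']
  simp only [map_sub, map_smul, sub_apply, smul_apply, smul_eq_mul, h1, h2]
  ring

end LeviCivita

/-! ### Compatible torsion-free connections and Riemannian metrics -/

section Proper

open Filter Topology VectorField

/-- If the differential of a Minkowski norm annihilates the vectors `t v y`, and these vectors span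
the orthogonal complement of `y`, then the norm is Euclidean. -/
lemma IsMinkowski.exists_sq_eq {N : E3 → ℝ} (hN : IsMinkowski N) {b : E3 →L[ℝ] E3 →L[ℝ] ℝ}
    (hsymm : ∀ v w, b v w = b w v) (hpos : ∀ v, v ≠ 0 → 0 < b v v) {t : E3 → E3 → E3} {κ : ℝ}
    (hκ : κ ≠ 0) (ht : ∀ y z, t (t y z) y = κ • (b y y • z - b y z • y))
    (hd : ∀ y, y ≠ 0 → ∀ v, fderiv ℝ N y (t v y) = 0) : ∃ c : ℝ, ∀ y, N y ^ 2 = c * b y y := by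
  have hdiff : ∀ y, y ≠ 0 → DifferentiableAt ℝ N y := fun y hy =>
    (hN.smooth.contDiffAt (isOpen_ne_zero.mem_nhds hy)).differentiableAt (by simp)
  -- Euler's identity for the homogeneous function `N`.
  have heuler : ∀ y, y ≠ 0 → fderiv ℝ N y y = N y := by
    intro y hy
    have h1 : HasDerivAt (fun s : ℝ => s • y) y 1 := by
      simpa using (hasDerivAt_id (1 : ℝ)).smul_const y
    have h2 : HasDerivAt (N ∘ fun s : ℝ => s • y) (fderiv ℝ N y y) 1 :=
      HasFDerivAt.comp_hasDerivAt_of_eq (1 : ℝ) (hdiff y hy).hasFDerivAt h1 (by simp)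
    have h3 : HasDerivAt (fun s : ℝ => s * N y) (N y) 1 := by
      simpa using (hasDerivAt_id (1 : ℝ)).mul_const (N y)
    refine h2.unique (h3.congr_of_eventuallyEq ?_)
    filter_upwards [lt_mem_nhds zero_lt_one] with s hs using hN.homog y s hs
  have hN0 : N 0 = 0 := by
    have := hN.homog 0 2 two_pos
    rw [smul_zero] at this
    linarith
  have hgrad : ∀ y, y ≠ 0 → ∀ z, b y y * fderiv ℝ N y z = b y z * N y := by
    intro y hy z
    have h := hd y hy (t y z)
    rw [ht, map_smul, map_sub, map_smul, map_smul, heuler y hy, smul_eq_mul, smul_eq_mul,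
      smul_eq_mul] at h
    linarith [(mul_eq_zero.1 h).resolve_left hκ]
  have hfd : ∀ y, y ≠ 0 → HasFDerivAt (fun y => N y ^ 2 / b y y) (0 : E3 →L[ℝ] ℝ) y := by
    intro y hy
    have h1 : HasFDerivAt (fun y => N y ^ 2) _ y := (hdiff y hy).hasFDerivAt.pow 2
    have h2 : HasFDerivAt (fun y => b y y) _ y := b.hasFDerivAt.clm_apply (hasFDerivAt_id y)
    have h0 := (hpos y hy).ne'
    have h3 := h1.mul (HasDerivAt.comp_hasFDerivAt (f := fun y => b y y) y (hasDerivAt_inv h0) h2)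
    simp only [div_eq_mul_inv]
    refine h3.congr_fderiv ?_
    ext z
    simp [hsymm z y]
    field_simp
    linear_combination (2 * N y) * hgrad y hy z
  obtain ⟨c, hc⟩ := isOpen_ne_zero.exists_is_const_of_fderiv_eq_zero (𝕜 := ℝ)
    (isConnected_compl_singleton_of_one_lt_rank
      (by rw [← Module.finrank_eq_rank, finrank_euclideanSpace_fin]; norm_num) 0).isPreconnected
    (fun y hy => (hfd y hy).differentiableAt.differentiableWithinAt)
    (fun y hy => (hfd y hy).fderiv)
  refine ⟨c, fun y => ?_⟩
  rcases eq_or_ne y 0 with rfl | hy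
  · simp [hN0]
  · rw [← hc y hy, div_mul_cancel₀ _ (hpos y hy).ne']

variable {M : Type*} [TopologicalSpace M] [ChartedSpace E3 M] [IsManifold (𝓡 3) ∞ M]
  {F : FinslerMetric M} {G : RMetric M} {cov cov₁ cov₂ : Connection M}

/-- Uniqueness of the Levi-Civita connection. -/
lemma IsLeviCivita.cov_eq [T2Space M] (h₁ : IsLeviCivita G cov₁) (h₂ : IsLeviCivita G cov₂)
    {Y : Π p : M, TangentSpace (𝓡 3) p} (hY : SmoothField Y) (p : M) (v : TangentSpace (𝓡 3) p) :
    cov₁ Y p v = cov₂ Y p v := by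
  have hm : ∀ {Y Z : Π p : M, TangentSpace (𝓡 3) p}, SmoothField Y → SmoothField Z →
      ∀ v, G.inner p (cov₁ Y p v - cov₂ Y p v) (Z p) =
        -G.inner p (cov₁ Z p v - cov₂ Z p v) (Y p) := by
    intro Y Z hY hZ v
    have e1 := h₁.metrical Y Z hY hZ p v
    have e2 := h₂.metrical Y Z hY hZ p v
    rw [e1, G.symm p (Y p), G.symm p (Y p)] at e2
    simp only [map_sub, sub_apply]
    linarith
  have ht : ∀ {X Y : Π p : M, TangentSpace (𝓡 3) p}, SmoothField X → SmoothField Y →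
      cov₁ Y p (X p) - cov₂ Y p (X p) = cov₁ X p (Y p) - cov₂ X p (Y p) := by
    intro X Y hX hY
    have e1 := (CovariantDerivative.torsion_eq_zero_iff _).1 h₁.torsion_eq_zero
      (hX.mdifferentiableAt p) (hY.mdifferentiableAt p)
    have e2 := (CovariantDerivative.torsion_eq_zero_iff _).1 h₂.torsion_eq_zero
      (hX.mdifferentiableAt p) (hY.mdifferentiableAt p)
    linear_combination (norm := module) e1 - e2
  obtain ⟨X, hX, rfl⟩ := exists_smoothField_eq p v
  -- The difference is symmetric in its two arguments and skew with respect to `G`.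
  have key : ∀ Z : Π p : M, TangentSpace (𝓡 3) p, SmoothField Z →
      G.inner p (cov₁ Y p (X p) - cov₂ Y p (X p)) (Z p) = 0 := by
    intro Z hZ
    have a1 := hm hY hZ (X p)
    rw [ht hX hZ] at a1
    have a2 := hm hX hY (Z p)
    rw [ht hZ hY] at a2
    have a3 := hm hZ hX (Y p)
    rw [ht hY hX] at a3
    linarith
  obtain ⟨Z, hZ, hZp⟩ := exists_smoothField_eq p (cov₁ Y p (X p) - cov₂ Y p (X p))
  have h := key Z hZ
  rw [hZp] at h
  by_contra hne
  exact (G.pos p _ (sub_ne_zero.2 hne)).ne' h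

/-- Parallel transports of two compatible connections differ by isometries of the Minkowski norm,
so that the difference of the connections consists of infinitesimal isometries. -/
lemma fderiv_connCoeff_sub_eq_zero [T2Space M] (h₁ : IsCompatible F cov₁)
    (hc₁ : cov₁.ContMDiffCovariantDerivative ∞) (h₂ : IsCompatible F cov₂)
    (hc₂ : cov₂.ContMDiffCovariantDerivative ∞) {p₀ q : M} (hq : q ∈ (chartAt E3 p₀).source)
    {y : E3} (hy : y ≠ 0) (v : E3) :
    fderiv ℝ (F.localFiber p₀ q) y (connCoeff cov₂ p₀ q y v - connCoeff cov₁ p₀ q y v) = 0 := by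
  obtain ⟨P, hP0, hP, hPF⟩ := h₁.exists_transport hc₁ hq v
  obtain ⟨R, hR0, hR, hRF⟩ := h₂.exists_transport hc₂ hq v
  have hunit : ∀ᶠ s in 𝓝 (0 : ℝ), IsUnit (R s) := by
    have : IsUnit (R 0) := by rw [hR0]; exact isUnit_one
    exact hR.continuousAt.eventually (Units.isOpen.mem_nhds this)
  let Q : ℝ → E3 →L[ℝ] E3 := fun s => Ring.inverse (R s)
  have hQ0 : Q 0 = 1 := by
    simp only [Q, hR0]
    exact Ring.inverse_one _
  have hQ : HasDerivAt Q ((connCoeff cov₂ p₀ q).flip v) 0 := hasDerivAt_ringInverse hR0 hR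
  have hcurve : HasDerivAt (fun s => Q s (P s y))
      (connCoeff cov₂ p₀ q y v - connCoeff cov₁ p₀ q y v) 0 := by
    refine (hQ.clm_apply (hP.clm_apply (hasDerivAt_const (0 : ℝ) y))).congr_deriv ?_
    rw [hQ0, hP0]
    simp [sub_eq_add_neg]
  have h0 : Q 0 (P 0 y) = y := by
    rw [hQ0, hP0]
    rfl
  have hdiff : DifferentiableAt ℝ (F.localFiber p₀ q) y :=
    ((F.isMinkowski_localFiber hq).smooth.contDiffAt
      (isOpen_ne_zero.mem_nhds hy)).differentiableAt (by simp)
  have h1 : HasDerivAt (F.localFiber p₀ q ∘ fun s => Q s (P s y)) _ 0 :=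
    HasFDerivAt.comp_hasDerivAt_of_eq (0 : ℝ) hdiff.hasFDerivAt hcurve h0.symm
  refine h1.unique ((hasDerivAt_const (0 : ℝ) (F.localFiber p₀ q y)).congr_of_eventuallyEq ?_)
  filter_upwards [hPF, hRF, hunit] with s hs hs' hu
  have hRQ : R s (Q s (P s y)) = P s y :=
    congrArg (fun T : E3 →L[ℝ] E3 => T (P s y)) (Ring.mul_inverse_cancel (R s) hu)
  rw [Function.comp, ← hs', hRQ, hs]

end Proper

section Final

open Filter Topology VectorField

variable {M : Type*} [TopologicalSpace M] [ChartedSpace E3 M] [IsManifold (𝓡 3) ∞ M]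
  {F : FinslerMetric M} {G : RMetric M} {cov cov₁ cov₂ : Connection M}

/-- The vectors `T (v, y)` span the orthogonal complement of `y`. -/
lemma IsTorsionFactor.torsion_torsion {κ : M → ℝ} (hκ : IsTorsionFactor G cov κ)
    (hT : IsSkewTorsion G cov) (p : M) (y z : TangentSpace (𝓡 3) p) :
    cov.torsion p (cov.torsion p y z) y = κ p • (G.inner p y y • z - G.inner p y z • y) := by
  have key : ∀ w, G.inner p (cov.torsion p (cov.torsion p y z) y -
      κ p • (G.inner p y y • z - G.inner p y z • y)) w = 0 := by
    intro w
    have h1 : G.inner p (cov.torsion p (cov.torsion p y z) y) w =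
        G.inner p (cov.torsion p y w) (cov.torsion p y z) := hT.cyc ..
    simp only [map_sub, map_smul, sub_apply, smul_apply, smul_eq_mul, h1]
    rw [hκ, G.symm p w z, G.symm p w y]
    ring
  by_contra hne
  exact (G.pos p _ (sub_ne_zero.2 hne)).ne' (key _)

/-- In a chart, the difference of a connection and the Levi-Civita connection is half the
torsion. -/
lemma connCoeff_symmetrization_sub [T2Space M] {p₀ q : M} (hq : q ∈ (chartAt E3 p₀).source)
    (h₁ : IsLeviCivita G (symmetrization cov)) (h₂ : IsLeviCivita G cov₂) (y v : E3) :
    connCoeff cov₂ p₀ q y v - connCoeff cov p₀ q y v = (1 / 2 : ℝ) • coords p₀ q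
      (cov.torsion q (coordField p₀ y q) (coordField p₀ v q)) := by
  obtain ⟨Y, hY, hYe⟩ := exists_smoothField_coordField hq y
  have h : ∀ c : Connection M, c (coordField p₀ y) q = c Y q := fun c =>
    c.isCovariantDerivativeOnUniv.congr_of_eventuallyEq (mdifferentiableAt_coordField hq y)
      (hY.mdifferentiableAt q) univ_mem (hYe.mono fun p hp => hp.symm)
  rw [connCoeff_apply _ hq, connCoeff_apply _ hq, h, h, ← h₁.cov_eq h₂ hY, symmetrization_apply,
    hYe.self_of_nhds]
  simp only [← frameEquiv_symm_apply hq, map_add, map_smul]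
  abel

/-- If the torsion does not vanish, a second compatible connection without torsion forces the
Finsler metric to be Riemannian. -/
lemma isRiemannian_of_isClassicalBerwald [T2Space M] (hcomp : IsCompatible F cov)
    (hcov : cov.ContMDiffCovariantDerivative ∞)
    (hT : IsSkewTorsion (hcomp.averagedMetric hcov) cov) {κ : M → ℝ}
    (hκ : IsTorsionFactor (hcomp.averagedMetric hcov) cov κ) (hκ0 : ∀ p, κ p ≠ 0)
    (hB : IsClassicalBerwald F) : F.IsRiemannian := by
  obtain ⟨cov₂, hcov₂, hcomp₂, htor₂⟩ := hB
  set G := hcomp.averagedMetric hcov with hG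
  have h₁ : IsLeviCivita G (symmetrization cov) :=
    isLeviCivita_symmetrization (hcomp.isMetrical hcov hcomp hcov) hT hcov
  have h₂ : IsLeviCivita G cov₂ := ⟨hcov₂, htor₂, hcomp.isMetrical hcov hcomp₂ hcov₂⟩
  intro p
  have hp := mem_chart_source E3 p
  let A := frameEquiv p p hp
  obtain ⟨c, hc⟩ := (F.isMinkowski_localFiber hp).exists_sq_eq (b := F.localForm p p)
    (t := fun v y => A.symm (cov.torsion p (A v) (A y))) (κ := κ p)
    (fun v w => by
      rw [F.localForm_apply hp, F.localForm_apply hp, F.avgInner_symm])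
    (fun v hv => by
      rw [F.localForm_apply hp]
      exact F.avgInner_pos p ((map_ne_zero_iff A A.injective).2 hv)) (hκ0 p)
    (fun y z => by
      simp only [ContinuousLinearEquiv.apply_symm_apply]
      rw [hκ.torsion_torsion hT, F.localForm_apply hp, F.localForm_apply hp]
      simp only [map_smul, map_sub, ContinuousLinearEquiv.symm_apply_apply]
      rfl)
    (fun y hy v => by
      have h := fderiv_connCoeff_sub_eq_zero hcomp hcov hcomp₂ hcov₂ hp hy v
      rw [connCoeff_symmetrization_sub hp h₁ h₂, map_smul, cov.torsion_antisymm,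
        ← frameEquiv_symm_apply hp, map_neg, map_neg] at h
      simpa [A, frameEquiv_apply] using h)
  refine ⟨c • LinearMap.BilinMap.toQuadraticMap (F.avgInner p).toLinearMap₁₂, fun v => ?_⟩
  have h := hc (coords p p v)
  rw [F.localForm_apply hp, FinslerMetric.localFiber, coordField_coords hp] at h
  exact h

end Final

/-! ### The torsion function -/

section TorsionFunction

open Filter Topology

variable {M : Type*} [TopologicalSpace M] [ChartedSpace E3 M] [IsManifold (𝓡 3) ∞ M]
  {F : FinslerMetric M} {cov : Connection M}

/-- The basis `∂₁, ∂₂, ∂₃` of a tangent space that belongs to the preferred chart at `p₀`. -/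
def coordBasis {p₀ p : M} (hp : p ∈ (chartAt E3 p₀).source) :
    Module.Basis (Fin 3) ℝ (TangentSpace (𝓡 3) p) :=
  (EuclideanSpace.basisFun (Fin 3) ℝ).toBasis.map (frameEquiv p₀ p hp).toLinearEquiv

lemma coordBasis_apply {p₀ p : M} (hp : p ∈ (chartAt E3 p₀).source) (i : Fin 3) :
    coordBasis hp i = coordField p₀ (stdVec i) p := by
  simp only [coordBasis, Module.Basis.map_apply, OrthonormalBasis.coe_toBasis,
    EuclideanSpace.basisFun_apply]
  rfl

lemma HasTotallyAntisymmetricTorsion.isSkewTorsion (h : HasTotallyAntisymmetricTorsion F cov)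
    {G : RMetric M} (hG : ∀ p v w, G.inner p v w = F.averaged p v w) : IsSkewTorsion G cov := by
  intro p u v w
  obtain ⟨τ, hτ⟩ := h p
  rw [hG, hG, hτ, hτ]
  have h1 := τ.map_swap ![u, w, v] (i := 1) (j := 2) (by decide)
  rw [← h1]
  congr 1
  ext i
  fin_cases i <;> rfl

/-- The torsion of a connection with totally anti-symmetric torsion satisfies the Lagrange identity
with the square of the torsion function as a factor. -/
lemma HasTotallyAntisymmetricTorsion.exists_torsionFactor
    (h : HasTotallyAntisymmetricTorsion F cov) {G : RMetric M}
    (hG : ∀ p v w, G.inner p v w = F.averaged p v w) :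
    ∃ κ : M → ℝ, IsTorsionFactor G cov κ ∧ (∀ p, 0 ≤ κ p) ∧
      ∀ p₀, ∀ p ∈ (chartAt E3 p₀).source, torsionFunction F cov p₀ p ^ 2 = κ p := by
  choose τ hτ using h
  have h1 := fun p => exists_lagrange_identity (B := (G.inner p).toLinearMap₁₂)
    (T := fun a b => cov.torsion p a b) (τ := τ p) (finrank_tangentSpace p) (G.symm p) (G.pos p)
    (fun a b c => (hG p _ _).trans (hτ p a b c))
  choose κ hκ0 hκ hκdet using h1
  refine ⟨κ, hκ, hκ0, fun p₀ p hp => ?_⟩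
  have h2 := gram_det_pos (B := (G.inner p).toLinearMap₁₂) (finrank_tangentSpace p) (G.symm p)
    (G.pos p) (coordBasis hp)
  have h3 : (Matrix.of fun i j => (G.inner p).toLinearMap₁₂ (coordBasis hp i) (coordBasis hp j)) =
      Matrix.of fun i j : Fin 3 =>
        F.averaged p (coordField p₀ (stdVec i) p) (coordField p₀ (stdVec j) p) := by
    ext i j
    rw [Matrix.of_apply, Matrix.of_apply, coordBasis_apply, coordBasis_apply]
    exact hG p _ _
  have h4 : τ p ![coordField p₀ (stdVec 0) p, coordField p₀ (stdVec 1) p,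
      coordField p₀ (stdVec 2) p] = τ p (coordBasis hp) := by
    congr 1
    funext i
    rw [coordBasis_apply]
    fin_cases i <;> rfl
  have h5 := hκdet p (coordBasis hp)
  rw [h3] at h2 h5
  rw [torsionFunction, hτ, h4, div_pow, Real.sq_sqrt h2.le, h5, mul_div_cancel_right₀ _ h2.ne']

lemma continuousAt_torsionFunction [T2Space M] (hcov : cov.ContMDiffCovariantDerivative ∞)
    {G : RMetric M} (hG : ∀ p v w, G.inner p v w = F.averaged p v w) {p₀ p : M}
    (hp : p ∈ (chartAt E3 p₀).source) : ContinuousAt (torsionFunction F cov p₀) p := by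
  have hX : ∀ i, ∃ X : Π p : M, TangentSpace (𝓡 3) p, SmoothField X ∧
      ∀ᶠ q in 𝓝 p, X q = coordField p₀ (stdVec i) q := fun i =>
    exists_smoothField_coordField hp (stdVec i)
  choose X hX hXe using hX
  have hc : ∀ {Y Z : Π p : M, TangentSpace (𝓡 3) p}, SmoothField Y → SmoothField Z →
      ContinuousAt (fun q => G.inner q (Y q) (Z q)) p := fun hY hZ =>
    (mdifferentiableAt_inner G (hY.mdifferentiableAt p) (hZ.mdifferentiableAt p)).continuousAt
  have hM : ContinuousAt (fun q => Matrix.det (Matrix.of fun i j : Fin 3 =>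
      G.inner q (X i q) (X j q))) p := by
    have : ContinuousAt (fun q => Matrix.of fun i j : Fin 3 => G.inner q (X i q) (X j q)) p :=
      continuousAt_pi.2 fun i => continuousAt_pi.2 fun j => hc (hX i) (hX j)
    exact (Continuous.matrix_det continuous_id).continuousAt.comp this
  have hb : ∀ i, coordBasis hp i = X i p := fun i =>
    (coordBasis_apply hp i).trans (hXe i).self_of_nhds.symm
  have h2 := gram_det_pos (B := (G.inner p).toLinearMap₁₂) (finrank_tangentSpace p) (G.symm p)
    (G.pos p) (coordBasis hp)
  have h3 : ContinuousAt (fun q => G.inner q (torsionField cov (X 0) (X 1) q) (X 2 q) /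
      Real.sqrt (Matrix.det (Matrix.of fun i j : Fin 3 => G.inner q (X i q) (X j q)))) p := by
    refine (hc ((hX 0).torsionField hcov (hX 1)) (hX 2)).div
      (Real.continuous_sqrt.continuousAt.comp hM) ?_
    simp only [hb] at h2
    exact (Real.sqrt_pos.2 h2).ne'
  refine h3.congr ?_
  filter_upwards [hXe 0, hXe 1, hXe 2] with q h0 h1 h2
  have hi : ∀ i, X i q = coordField p₀ (stdVec i) q := by
    intro i
    fin_cases i <;> assumption
  simp only [torsionFunction, torsionField, hi, hG]

lemma hasConstantSectionalCurvature_averaged [T2Space M] {κ : M → ℝ} {G : RMetric M}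
    (hG : ∀ p v w, G.inner p v w = F.averaged p v w) (hκ : IsTorsionFactor G cov κ) {k : ℝ}
    (hk : ∀ p, κ p = k) (hmet : IsMetrical G cov) (hT : IsSkewTorsion G cov)
    (hcov : cov.ContMDiffCovariantDerivative ∞) (hflat : IsFlat cov) :
    HasConstantSectionalCurvature F.averaged (k / 4) :=
  ⟨G, symmetrization cov, hG, isLeviCivita_symmetrization hmet hT hcov, fun X Y hX hY p h => by
    rw [sectionalCurvature_symmetrization hκ hmet hT hcov hflat hX hY h, hk]⟩

/-- A torsion factor zero means vanishing torsion. -/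
lemma IsTorsionFactor.torsion_eq_zero {κ : M → ℝ} {G : RMetric M} (hκ : IsTorsionFactor G cov κ)
    (h0 : ∀ p, κ p = 0) : cov.torsion = 0 := by
  funext p
  ext1 u
  ext1 v
  by_contra hne
  have h := hκ p u v u v
  rw [h0, zero_mul] at h
  exact (G.pos p _ hne).ne' h

end TorsionFunction

end FinslerThree

end

theorem mainTheorem2 {M : Type*} [TopologicalSpace M] [T2Space M] [ConnectedSpace M]
    [ChartedSpace FinslerThree.E3 M] [IsManifold (𝓡 3) ∞ M]
    (F : FinslerThree.FinslerMetric M) (hF : ¬ F.IsRiemannian)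
    (cov : FinslerThree.Connection M) (hsmooth : cov.ContMDiffCovariantDerivative ∞)
    (hcomp : FinslerThree.IsCompatible F cov) (hflat : FinslerThree.IsFlat cov)
    (htors : FinslerThree.HasTotallyAntisymmetricTorsion F cov) :
    (FinslerThree.IsClassicalBerwald F ∧
        FinslerThree.HasConstantSectionalCurvature F.averaged 0 ∧
        ∀ p₀ : M, ∀ p ∈ (chartAt FinslerThree.E3 p₀).source,
          FinslerThree.torsionFunction F cov p₀ p = 0) ∨
      (FinslerThree.IsProperGeneralizedBerwald F ∧
        (∃ κ : ℝ, 0 < κ ∧ FinslerThree.HasConstantSectionalCurvature F.averaged κ) ∧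
        ∃ c : ℝ, 0 < c ∧ ∀ p₀ : M, ∀ p ∈ (chartAt FinslerThree.E3 p₀).source,
          |FinslerThree.torsionFunction F cov p₀ p| = c ∧
            ∀ᶠ q in nhds p, FinslerThree.torsionFunction F cov p₀ q =
              FinslerThree.torsionFunction F cov p₀ p) := by
  have hG := hcomp.averagedMetric_inner hsmooth
  have hmet := hcomp.isMetrical hsmooth hcomp hsmooth
  have hT := htors.isSkewTorsion hG
  obtain ⟨κ, hκ, hκ0, hf⟩ := htors.exists_torsionFactor hG
  obtain ⟨o⟩ : Nonempty M := inferInstance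
  have hconst : ∀ p, κ p = κ o := fun p => hκ.eq hmet hT hsmooth hflat p o
  have hcurv := FinslerThree.hasConstantSectionalCurvature_averaged hG hκ hconst hmet hT hsmooth
    hflat
  rcases (hκ0 o).eq_or_lt with h0 | h0
  · left
    have hz : ∀ p, κ p = 0 := fun p => (hconst p).trans h0.symm
    refine ⟨⟨cov, hsmooth, hcomp, hκ.torsion_eq_zero hz⟩, by simpa [← h0] using hcurv,
      fun p₀ p hp => ?_⟩
    have := hf p₀ p hp
    rw [hz] at this
    exact pow_eq_zero_iff two_ne_zero |>.1 this
  · right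
    refine ⟨⟨⟨cov, hsmooth, hcomp⟩, fun hB => hF ?_⟩, ⟨κ o / 4, by positivity, hcurv⟩,
      Real.sqrt (κ o), Real.sqrt_pos.2 h0, fun p₀ p hp => ⟨?_, ?_⟩⟩
    · exact FinslerThree.isRiemannian_of_isClassicalBerwald hcomp hsmooth hT hκ
        (fun p => by rw [hconst]; exact h0.ne') hB
    · rw [← hconst p, ← hf p₀ p hp, Real.sqrt_sq_eq_abs]
    · -- Near `p` the value at `p` and the nearby value have a nonzero sum and equal squares.
      have hp0 : FinslerThree.torsionFunction F cov p₀ p ≠ 0 := by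
        intro h
        have := hf p₀ p hp
        rw [h, hconst] at this
        linarith
      have hc := (FinslerThree.continuousAt_torsionFunction hsmooth hG hp).add_const
        (FinslerThree.torsionFunction F cov p₀ p)
      have hne := hc.eventually_ne (y := 0) (by simpa [← two_mul] using hp0)
      filter_upwards [hne, (chartAt FinslerThree.E3 p₀).open_source.mem_nhds hp] with q hq hqs
      have hsq := (hf p₀ q hqs).trans ((hconst q).trans ((hconst p).symm.trans (hf p₀ p hp).symm))
      rcases sq_eq_sq_iff_eq_or_eq_neg.1 hsq with h | h
      · exact h
      · exact absurd (by rw [h]; ring) hq
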